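/- Let $\mathbb F_q$ be a finite field, $\theta$ an automorphism of $\mathbb F_q$, and $R=\mathbb F_q[X;\theta]$ the skew polynomial ring with $Xa=\theta(a)X$. Vectors are row vectors and $A_t$ denotes the transpose of $A$. For a square matrix $A$, $\Theta\circ A$ is the semi-linear map $\vec v\mapsto(\theta(v_1),\theta(v_2),\dots)A$. For $i=1,\dots,r$ let $n_i\ge 1$, let $a_{i,0},\dots,a_{i,n_i-1}\in\mathbb F_q$ with $a_{i,0}\ne0$, let $M_i$ be the $n_i\times n_i$ companion matrix with ones above the diagonal and last row $(a_{i,0},\dots,a_{i,n_i-1})$, and let $f_i=(-1)^{n_i}(X^{n_i}-\sum_{j}a_{i,j}X^j)\in R$. Put $n=\sum_i n_i$, $\mathbb F_q^n=\mathbb F_q^{n_1}\times\dots\times\mathbb F_q^{n_r}$. Let $C$ be an invertible $n\times n$ matrix and let $T=\Theta\circ M$ satisfy $T=C^{-1}\,(\Theta\circ\mathrm{diag}(M_1,\dots,M_r))\,C$ (maps composed from left to right). Let $\pi_i:\mathbb F_q^{n_i}\to R/Rf_i$ be the bijection $\vec c\mapsto\sum_j c_jX^j$. An $f_i$-module $\theta$-code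 $(g)$ is a linear code in $\mathbb F_q^{n_i}$ corresponding under $\pi_i$ to $Rg/Rf_i$, where $g$ is a right divisor of $f_i$. A product $T$-code is a linear code in $\mathbb F_q^n$ that is invariant under $T$ and has the form $(\mathcal D_1\times\dots\times\mathcal D_r)C$ with each $\mathcal D_i$ an $f_i$-module $\theta$-code. Let $m_i$ be the least integer $\geq 1$ such that $X^{m_i}-1=f_ip$ for some $p\in R$ (it exists), and define $q_{f_i}$ by $X^{m_i}-1=f_iq_{f_i}$. Let $P_i$ be the $m_i\times m_i$ companion matrix with last row $(1,0,\dots,0)$, and let $Q_i$ be the $n_i\times m_i$ matrix with rows $\vec q_{f_i}(\Theta\circ P_i)^k$, $0\le k<n_i$, where $\vec q_{f_i}\in\mathbb F_q^{m_i}$ is the coefficient vector of $q_{f_i}$. Put $B_i=Q_i(Q_i)_t$, $\widehat Q=\mathrm{diag}(Q_1,\dots,Q_r)$ and $B=C^{-1}\widehat Q\,\widehat Q_t(C^{-1})_t$. The quasi-Euclidean dual of a linear code $\mathcal C\subseteq\mathbb F_q^n$ is $\mathcal C^*=\{\vec x\mid \vec xB\vec c_t=0\ \forall\,\vec c\in\mathcal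 C\}$; that of a linear code in $\mathbb F_q^{n_i}$ is defined in the same way with $B_i$. **Theorem.** Assume that the order of $\theta$ divides $m_i$ for every $i$. Let $\mathcal C_i=(g_i)$ be an $f_i$-module $\theta$-code of dimension $k_i$ for $i=1,\dots,r$, and let $\mathcal C_T=(\mathcal C_1\times\dots\times\mathcal C_r)C$. Then $$\mathcal C_T^*=(\mathcal C_1^*\times\dots\times\mathcal C_r^*)C,\qquad \mathcal C_i^*=(\mathcal C_iB_i)^\perp,$$ where $\perp$ is the Euclidean dual; each $\mathcal C_i^*$ is an $f_i$-module $\theta$-code, and $\mathcal C_T^*$ is a product $T$-code. Furthermore, for every $i$ there are $h_i=\sum_{j=0}^{k_i}h_{i,j}X^j\in R$ with $X^{m_i}-1=g_i\,q_{f_i}\,h_i$ and, with $h_i^\perp:=\sum_{j=0}^{k_i}\theta^j(h_{i,k_i-j})X^j$, a least left common multiple $\mathrm{llcm}(h_i^\perp,q_{f_i})$ and some $g_i^*\in R$ with $$g_i^*\,q_{f_i}\equiv\mathrm{llcm}(h_i^\perp,q_{f_i})\pmod{R(X^{m_i}-1)} .$$ For every such choice, with $s_i=\dim\mathcal C_i^*$,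 the matrix $G_i^*$ with rows $\pi_i^{-1}(g_i^*)(\Theta\circ M_i)^k$, $0\le k<s_i$, is a generator matrix of $\mathcal C_i^*$ (its rows are a basis), and $\mathrm{diag}(G_1^*,\dots,G_r^*)\cdot C$ is a generator matrix of $\mathcal C_T^*$. -/

import Mathlib

noncomputable section

namespace SemilinearCodes

open Matrix

variable {F : Type*} [Field F]

/-! ### Linear codes, duals and generator matrices (vectors are row vectors) -/

/-- The semi-linear map `T = Θ ∘ M`, `v ↦ (θ v₁, …, θ vₙ) M`. -/
def semilin {ι : Type*} [Fintype ι] (θ : F ≃+* F) (M : Matrix ι ι F) (v : ι → F) : ι → F :=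
  (fun j => θ (v j)) ᵥ* M

/-- A linear code is a `T`-code, `T = Θ ∘ M`, if it is invariant under `T`. -/
def IsTCode {ι : Type*} [Fintype ι] (θ : F ≃+* F) (M : Matrix ι ι F)
    (𝒞 : Submodule F (ι → F)) : Prop :=
  ∀ v ∈ 𝒞, semilin θ M v ∈ 𝒞

/-- The Euclidean dual `𝒞^⊥`. -/
def euclDual {ι : Type*} [Fintype ι] (𝒞 : Submodule F (ι → F)) : Submodule F (ι → F) where
  carrier := {x | ∀ c ∈ 𝒞, x ⬝ᵥ c = 0}
  add_mem' hx hy c hc := by rw [add_dotProduct, hx c hc, hy c hc, add_zero]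
  zero_mem' c _ := zero_dotProduct c
  smul_mem' t x hx c hc := by rw [smul_dotProduct, hx c hc, smul_zero]

/-- The dual of `𝒞` with respect to the scalar product `x B cᵗ`. -/
def dualWrt {ι : Type*} [Fintype ι] (B : Matrix ι ι F) (𝒞 : Submodule F (ι → F)) :
    Submodule F (ι → F) where
  carrier := {x | ∀ c ∈ 𝒞, (x ᵥ* B) ⬝ᵥ c = 0}
  add_mem' hx hy c hc := by rw [add_vecMul, add_dotProduct, hx c hc, hy c hc, add_zero]
  zero_mem' c _ := by rw [zero_vecMul, zero_dotProduct]
  smul_mem' t x hx c hc := by rw [smul_vecMul, smul_dotProduct, hx c hc, smul_zero]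

/-- The code `𝒞 A = {c A | c ∈ 𝒞}`. -/
def codeMul {ι κ : Type*} [Fintype ι] (𝒞 : Submodule F (ι → F)) (A : Matrix ι κ F) :
    Submodule F (κ → F) :=
  𝒞.map A.vecMulLinear

/-- `G` is a generator matrix of `𝒞`: its rows are a basis of `𝒞`. -/
def IsGeneratorMatrix {ι κ : Type*} (G : Matrix κ ι F) (𝒞 : Submodule F (ι → F)) : Prop :=
  LinearIndependent F (fun k => G k) ∧ Submodule.span F (Set.range fun k => G k) = 𝒞

/-- The product code `𝒞₁ × … × 𝒞ᵣ` in `F^{n₁} × … × F^{nᵣ} = F^n`. -/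
def prodCode {r : ℕ} {d : Fin r → ℕ} (𝒞 : ∀ i, Submodule F (Fin (d i) → F)) :
    Submodule F ((i : Fin r) × Fin (d i) → F) where
  carrier := {v | ∀ i, (fun j => v ⟨i, j⟩) ∈ 𝒞 i}
  add_mem' hv hw i := (𝒞 i).add_mem (hv i) (hw i)
  zero_mem' i := (𝒞 i).zero_mem
  smul_mem' t _ hv i := (𝒞 i).smul_mem t (hv i)

/-- The companion matrix with ones above the diagonal and last row `a`. -/
def companion {n : ℕ} (a : Fin n → F) : Matrix (Fin n) (Fin n) F :=
  Matrix.of fun i j =>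
    if (i : ℕ) + 1 = n then a j else if (j : ℕ) = (i : ℕ) + 1 then 1 else 0

/-- The cyclic permutation matrix `P`, the companion matrix with last row `(1, 0, …, 0)`. -/
def cyclicMatrix (F : Type*) [Field F] (m : ℕ) : Matrix (Fin m) (Fin m) F :=
  companion fun j => if (j : ℕ) = 0 then 1 else 0

/-! ### The skew polynomial ring `R = F[X; θ]`, `X a = θ(a) X`

Mathlib's `SkewPolynomial F` reads the endomorphism off an action of `Multiplicative ℕ`. -/

variable [MulSemiringAction (Multiplicative ℕ) F]

/-- `c₀ + c₁ X + … + c_{n-1} X^{n-1}`. -/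
def toPoly {n : ℕ} (c : Fin n → F) : SkewPolynomial F :=
  ∑ j : Fin n, SkewPolynomial.monomial (j : ℕ) (c j)

/-- `f = (-1)^n (X^n - a_{n-1} X^{n-1} - … - a₀)`. -/
def skewCharPoly {n : ℕ} (a : Fin n → F) : SkewPolynomial F :=
  (-1) ^ n * (SkewPolynomial.X ^ n - toPoly a)

/-- The left ideal `R f`. -/
def leftIdeal (f : SkewPolynomial F) : Submodule (SkewPolynomial F) (SkewPolynomial F) :=
  Submodule.span (SkewPolynomial F) {f}

/-- The map `π : F^n → R / R f`. -/
def toQuot {n : ℕ} (f : SkewPolynomial F) (c : Fin n → F) : SkewPolynomial F ⧸ leftIdeal f :=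
  (leftIdeal f).mkQ (toPoly c)

/-- `𝒞 = (g)` is the `f`-module `θ`-code generated by `g`: `g` is a right divisor of `f` and
`𝒞` corresponds to `R g / R f` under `π`. -/
def IsModuleCodeGenBy {n : ℕ} (f g : SkewPolynomial F) (𝒞 : Submodule F (Fin n → F)) : Prop :=
  (∃ p, f = p * g) ∧ ∀ c, c ∈ 𝒞 ↔ toQuot f c ∈ (leftIdeal g).map (leftIdeal f).mkQ

/-- `𝒞` is an `f`-module `θ`-code. -/
def IsModuleCode {n : ℕ} (f : SkewPolynomial F) (𝒞 : Submodule F (Fin n → F)) : Prop :=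
  ∃ g, IsModuleCodeGenBy f g 𝒞

/-- The linear code `𝒞` is a product `T`-code, `T = Θ ∘ M`, with respect to the matrix `C` and the
polynomials `fᵢ` with coefficients `a i`. -/
def IsProductTCode {r : ℕ} {d : Fin r → ℕ} (θ : F ≃+* F) (a : ∀ i, Fin (d i) → F)
    (M C : Matrix ((i : Fin r) × Fin (d i)) ((i : Fin r) × Fin (d i)) F)
    (𝒞 : Submodule F ((i : Fin r) × Fin (d i) → F)) : Prop :=
  IsTCode θ M 𝒞 ∧ ∃ 𝒟 : ∀ i, Submodule F (Fin (d i) → F),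
    (∀ i, IsModuleCode (skewCharPoly (a i)) (𝒟 i)) ∧ 𝒞 = codeMul (prodCode 𝒟) C

/-- `m`: the least `i ≥ 1` such that `X^i - 1 = f p` for some `p`. -/
def period (f : SkewPolynomial F) : ℕ :=
  sInf {i : ℕ | 0 < i ∧ ∃ p, SkewPolynomial.X ^ i - 1 = f * p}

/-- `q_f`: the polynomial with `X^m - 1 = f q_f`. -/
def cofactor (f : SkewPolynomial F) : SkewPolynomial F :=
  Classical.epsilon fun q => SkewPolynomial.X ^ period f - 1 = f * q

/-- The `n × m` matrix `Q` with rows `q_f (Θ ∘ P)^k`, `0 ≤ k < n`. -/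
def matQ (θ : F ≃+* F) (n : ℕ) (f : SkewPolynomial F) : Matrix (Fin n) (Fin (period f)) F :=
  Matrix.of fun k =>
    (semilin θ (cyclicMatrix F (period f)))^[(k : ℕ)] fun j => (cofactor f).coeff (j : ℕ)

/-- `Bᵢ = Qᵢ Qᵢᵗ`, for `f` with coefficients `a`. -/
def blockB {n : ℕ} (θ : F ≃+* F) (a : Fin n → F) : Matrix (Fin n) (Fin n) F :=
  matQ θ n (skewCharPoly a) * (matQ θ n (skewCharPoly a))ᵀ

/-- `B = C⁻¹ Q̂ Q̂ᵗ (C⁻¹)ᵗ` with `Q̂ = diag(Q₁, …, Qᵣ)`. -/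
def quasiB {r : ℕ} {d : Fin r → ℕ} (θ : F ≃+* F) (a : ∀ i, Fin (d i) → F)
    (C : Matrix ((i : Fin r) × Fin (d i)) ((i : Fin r) × Fin (d i)) F) :
    Matrix ((i : Fin r) × Fin (d i)) ((i : Fin r) × Fin (d i)) F :=
  C⁻¹ * blockDiagonal' (fun i => matQ θ (d i) (skewCharPoly (a i))) *
    (blockDiagonal' fun i => matQ θ (d i) (skewCharPoly (a i)))ᵀ * (C⁻¹)ᵀ

/-- The quasi-Euclidean dual `𝒞*` of a code in `F^n`. -/
def quasiDual {r : ℕ} {d : Fin r → ℕ} (θ : F ≃+* F) (a : ∀ i, Fin (d i) → F)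
    (C : Matrix ((i : Fin r) × Fin (d i)) ((i : Fin r) × Fin (d i)) F)
    (𝒞 : Submodule F ((i : Fin r) × Fin (d i) → F)) :
    Submodule F ((i : Fin r) × Fin (d i) → F) :=
  dualWrt (quasiB θ a C) 𝒞

/-- The quasi-Euclidean dual `𝒞ᵢ*` of a code in the factor `F^{nᵢ}`. -/
def blockDual {n : ℕ} (θ : F ≃+* F) (a : Fin n → F) (𝒞 : Submodule F (Fin n → F)) :
    Submodule F (Fin n → F) :=
  dualWrt (blockB θ a) 𝒞

/-- `l` is a least left common multiple of `p` and `q`. -/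
def IsLLCM (p q l : SkewPolynomial F) : Prop :=
  (∃ u, l = u * p) ∧ (∃ v, l = v * q) ∧ ∀ x, (∃ u, x = u * p) → (∃ v, x = v * q) → ∃ w, x = w * l

/-- `h^⊥ = ∑_{j=0}^{k} θ^j(h_{k-j}) X^j`. -/
def hPerp (θ : F ≃+* F) (k : ℕ) (h : SkewPolynomial F) : SkewPolynomial F :=
  ∑ j ∈ Finset.range (k + 1), SkewPolynomial.monomial j (θ^[j] (h.coeff (k - j)))

/-- The relations determining, from a code `𝒞 = (g)` of dimension `k`, the polynomial
`h = ∑_{j=0}^{k} h_j X^j`, the least left common multiple `l` of `h^⊥` and `q_f`, the polynomial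
`gs = g*` with `g* q_f ≡ l mod (X^m - 1)`, and the vector `u = π⁻¹(g*)`. -/
def IsDualGenerator {n : ℕ} (θ : F ≃+* F) (f g : SkewPolynomial F) (𝒞 : Submodule F (Fin n → F))
    (h l gs : SkewPolynomial F) (u : Fin n → F) : Prop :=
  (∀ j, Module.finrank F 𝒞 < j → h.coeff j = 0) ∧
  SkewPolynomial.X ^ period f - 1 = g * cofactor f * h ∧
  IsLLCM (hPerp θ (Module.finrank F 𝒞) h) (cofactor f) l ∧
  gs * cofactor f - l ∈ leftIdeal (SkewPolynomial.X ^ period f - 1) ∧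
  toQuot f u = (leftIdeal f).mkQ gs

/-- The `s × n` matrix with rows `u (Θ ∘ A)^k`, `0 ≤ k < s`. -/
def orbitMatrix {n : ℕ} (θ : F ≃+* F) (A : Matrix (Fin n) (Fin n) F) (u : Fin n → F) (s : ℕ) :
    Matrix (Fin s) (Fin n) F :=
  Matrix.of fun k => (semilin θ A)^[(k : ℕ)] u

end SemilinearCodes

end

/-! Write `q` for the cofactor of `f`, so `X ^ m - 1 = f q`. Since the order of `θ` divides `m`, the
element `X ^ m - 1` is central. As `F[X; θ]` has no zero divisors, two factors of `X ^ m - 1` may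
then be exchanged.

For one block, right multiplication by `q` embeds `R / R f` into `R / R (X ^ m - 1)`. In coordinates
this embedding is the matrix `Q` (`vecMul_matQ`), so `B = Q Qᵗ` is the pullback of the Euclidean
form. Hence `x` lies in the dual of `(g)` iff `x q` is orthogonal to `R g q`. If `f = p g`,
exchanging factors gives `X ^ m - 1 = g q p`, so `h = p`. By `orthogonal_iff_exists_mul_hPerp` the
Euclidean dual of `R g q` is `R h^⊥`. The condition on `x` thus becomes `x q ∈ R h^⊥ ∩ R q = R l`,
with `l` the least left common multiple. Writing `l = g' q` and cancelling `q` leaves `x ∈ R g'`,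
and `g'` is a right divisor of `f` because `X ^ m - 1 ∈ R l` (`exists_isModuleCodeGenBy_blockDual`).
The companion matrix acts as multiplication by `X` modulo `f`, so the shifts of `g'` form a basis.

For several blocks, the form is block diagonal after the change of coordinates by `C`, so duals are
taken block by block. -/

noncomputable section

/-! ### Degree, division with remainder and left ideals in `F[X; θ]`. -/

namespace SkewPolynomial

open Multiplicative

variable {F : Type*} [Field F]

/-- `p` has degree exactly `n`; in particular `p ≠ 0`. -/
def HasDegree (p : SkewPolynomial F) (n : ℕ) : Prop :=
  p.coeff n ≠ 0 ∧ ∀ j, n < j → p.coeff j = 0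

/-- `p` has degree less than `n`. -/
def DegreeLT (p : SkewPolynomial F) (n : ℕ) : Prop :=
  ∀ j, n ≤ j → p.coeff j = 0

lemma HasDegree.ne_zero {p : SkewPolynomial F} {n : ℕ} (h : HasDegree p n) : p ≠ 0 := by
  rintro rfl
  exact h.1 (coeff_zero n)

lemma HasDegree.degreeLT {p : SkewPolynomial F} {n k : ℕ} (h : HasDegree p n) (hk : n < k) :
    DegreeLT p k :=
  fun j hj => h.2 j (by omega)

lemma HasDegree.lt_of_degreeLT {p : SkewPolynomial F} {n k : ℕ} (h : HasDegree p n)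
    (hk : DegreeLT p k) : n < k := by
  by_contra hn
  exact h.1 (hk n (by omega))

lemma HasDegree.unique {p : SkewPolynomial F} {n k : ℕ} (h : HasDegree p n)
    (h' : HasDegree p k) : n = k := by
  rcases lt_trichotomy n k with hlt | heq | hlt
  · exact absurd (h.2 k hlt) h'.1
  · exact heq
  · exact absurd (h'.2 n hlt) h.1

lemma exists_hasDegree {p : SkewPolynomial F} (hp : p ≠ 0) : ∃ n, HasDegree p n := by
  have hs : p.support.Nonempty := by
    rw [Finset.nonempty_iff_ne_empty, Ne, support_eq_empty]
    exact hp
  refine ⟨p.support.max' hs, mem_support_iff.1 (p.support.max'_mem hs), fun j hj => ?_⟩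
  by_contra hc
  exact absurd (p.support.le_max' j (mem_support_iff.2 hc)) (by omega)

lemma exists_degreeLT (p : SkewPolynomial F) : ∃ n, DegreeLT p n := by
  by_cases hp : p = 0
  · exact ⟨0, fun j _ => by rw [hp, coeff_zero]⟩
  · obtain ⟨n, hn⟩ := exists_hasDegree hp
    exact ⟨n + 1, hn.degreeLT (Nat.lt_succ_self n)⟩

lemma DegreeLT.mono {p : SkewPolynomial F} {n k : ℕ} (h : DegreeLT p n) (hk : n ≤ k) :
    DegreeLT p k :=
  fun j hj => h j (hk.trans hj)

lemma DegreeLT.sub {p q : SkewPolynomial F} {n : ℕ} (hp : DegreeLT p n) (hq : DegreeLT q n) :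
    DegreeLT (p - q) n :=
  fun j hj => by rw [coeff_sub, hp j hj, hq j hj, sub_zero]

lemma coeff_finsetSum {ι : Type*} (s : Finset ι) (p : ι → SkewPolynomial F) (n : ℕ) :
    (∑ i ∈ s, p i).coeff n = ∑ i ∈ s, (p i).coeff n := by
  classical
  induction s using Finset.induction_on with
  | empty => simp
  | insert a s ha ih => rw [Finset.sum_insert ha, Finset.sum_insert ha, coeff_add, ih]

lemma coeff_smul (c : F) (p : SkewPolynomial F) (n : ℕ) : (c • p).coeff n = c * p.coeff n := rfl

/-- A polynomial of degree less than `n` is the sum of its monomials below `n`. -/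
lemma DegreeLT.eq_sum {p : SkewPolynomial F} {n : ℕ} (h : DegreeLT p n) :
    p = ∑ j ∈ Finset.range n, monomial j (p.coeff j) := by
  ext i
  simp only [coeff_finsetSum, coeff_monomial, Finset.sum_ite_eq', Finset.mem_range]
  split_ifs with hi
  · rfl
  · exact h i (by omega)

/-- Additive induction on monomials. -/
lemma induction_monomial {motive : SkewPolynomial F → Prop} (p : SkewPolynomial F)
    (zero : motive 0) (add : ∀ p q, motive p → motive q → motive (p + q))
    (mono : ∀ n c, motive (monomial n c)) : motive p :=
  SkewPolynomial.induction p zero fun n r _ _ _ hq => add _ _ (mono n r) hq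

variable [MulSemiringAction (Multiplicative ℕ) F]

lemma coeff_mul (p q : SkewPolynomial F) (n : ℕ) :
    (p * q).coeff n =
      ∑ x ∈ Finset.HasAntidiagonal.antidiagonal n, p.coeff x.1 * φ^[x.1] (q.coeff x.2) := by
  induction p using induction_monomial with
  | zero => simp
  | add p p' hp hp' => simp only [add_mul, coeff_add, hp, hp', Finset.sum_add_distrib]
  | mono i c =>
    induction q using induction_monomial with
    | zero => simp
    | add q q' hq hq' =>
      simp only [mul_add, coeff_add, hq, hq', iterate_map_add, Finset.sum_add_distrib]
    | mono j d =>
      rw [monomial_mul_monomial, coeff_monomial]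
      split_ifs with h
      · rw [Finset.sum_eq_single (i, j)]
        · simp [coeff_monomial]
        · rintro ⟨a, b⟩ hab hne
          simp only [coeff_monomial]
          by_cases h1 : i = a
          · by_cases h2 : j = b
            · exact absurd (by rw [h1, h2]) hne
            · simp [h2]
          · simp [h1]
        · intro hn
          exact absurd (Finset.HasAntidiagonal.mem_antidiagonal.2 h) hn
      · symm
        refine Finset.sum_eq_zero ?_
        rintro ⟨a, b⟩ hab
        rw [Finset.HasAntidiagonal.mem_antidiagonal] at hab
        simp only [coeff_monomial]
        by_cases h1 : i = a
        · have h2 : j ≠ b := by rintro rfl; subst h1; exact h hab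
          simp [h2]
        · simp [h1]

lemma φ_iterate_ne_zero {c : F} (hc : c ≠ 0) (n : ℕ) : φ^[n] c ≠ 0 := by
  intro h
  apply hc
  have hinj : Function.Injective (φ : F →+* F)^[n] := (φ : F →+* F).injective.iterate n
  exact hinj (by rw [h, iterate_map_zero])

lemma coeff_mul_zero (p q : SkewPolynomial F) : (p * q).coeff 0 = p.coeff 0 * q.coeff 0 := by
  simp [coeff_mul]

lemma coeff_mul_add {p q : SkewPolynomial F} {a b : ℕ} (hp : ∀ j, a < j → p.coeff j = 0)
    (hq : ∀ j, b < j → q.coeff j = 0) :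
    (p * q).coeff (a + b) = p.coeff a * φ^[a] (q.coeff b) := by
  rw [coeff_mul, Finset.sum_eq_single (a, b)]
  · rintro ⟨i, j⟩ hij hne
    rw [Finset.HasAntidiagonal.mem_antidiagonal] at hij
    rcases lt_trichotomy i a with h | h | h
    · simp [hq j (by simp only at hij; omega)]
    · exact absurd (by ext <;> simp only at hij ⊢ <;> omega) hne
    · simp [hp i h]
  · intro h
    exact absurd (Finset.HasAntidiagonal.mem_antidiagonal.2 (show a + b = a + b from rfl)) h

lemma HasDegree.mul {p q : SkewPolynomial F} {a b : ℕ} (hp : HasDegree p a)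
    (hq : HasDegree q b) : HasDegree (p * q) (a + b) := by
  refine ⟨?_, fun n hn => ?_⟩
  · rw [coeff_mul_add hp.2 hq.2]
    exact mul_ne_zero hp.1 (φ_iterate_ne_zero hq.1 a)
  · rw [coeff_mul]
    refine Finset.sum_eq_zero ?_
    rintro ⟨i, j⟩ hij
    rw [Finset.HasAntidiagonal.mem_antidiagonal] at hij
    simp only at hij ⊢
    by_cases h : a < i
    · rw [hp.2 i h, zero_mul]
    · rw [hq.2 j (by omega), iterate_map_zero, mul_zero]

/-- Leading coefficients multiply up to a twist by the injective map `φ`, so degrees add. All later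
cancellations of `X`, `q_f` and `g` rest on this. -/
instance : NoZeroDivisors (SkewPolynomial F) where
  eq_zero_or_eq_zero_of_mul_eq_zero {p q} h := by
    by_contra! hc
    obtain ⟨a, ha⟩ := exists_hasDegree hc.1
    obtain ⟨b, hb⟩ := exists_hasDegree hc.2
    exact (ha.mul hb).ne_zero h

/-- Division with remainder on the right. -/
lemma exists_eq_mul_add {b : SkewPolynomial F} {n : ℕ} (hb : HasDegree b n)
    (p : SkewPolynomial F) : ∃ w r, p = w * b + r ∧ DegreeLT r n := by
  obtain ⟨N, hN⟩ := exists_degreeLT p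
  induction N generalizing p with
  | zero => exact ⟨0, p, by simp, hN.mono (Nat.zero_le n)⟩
  | succ N ih =>
    by_cases hn : N < n
    · exact ⟨0, p, by simp, hN.mono hn⟩
    obtain ⟨k, rfl⟩ : ∃ k, N = k + n := ⟨N - n, by omega⟩
    -- The leading coefficient of `monomial k c * b` is `c * φ^[k] (b.coeff n)`, so the divisor must
    -- be twisted for the top terms to cancel.
    set c := p.coeff (k + n) / φ^[k] (b.coeff n) with hc
    have hmono : ∀ j, k < j → (monomial k c).coeff j = 0 := fun j hj => by
      rw [coeff_monomial, if_neg hj.ne]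
    have hlt : DegreeLT (p - monomial k c * b) (k + n) := by
      intro j hj
      rw [coeff_sub]
      rcases hj.eq_or_lt with rfl | hj
      · rw [coeff_mul_add hmono hb.2, coeff_monomial, if_pos rfl, hc,
          div_mul_cancel₀ _ (φ_iterate_ne_zero hb.1 k), sub_self]
      · rw [hN j hj, zero_sub, neg_eq_zero, coeff_mul]
        refine Finset.sum_eq_zero ?_
        rintro ⟨i, l⟩ hil
        rw [Finset.HasAntidiagonal.mem_antidiagonal] at hil
        simp only at hil ⊢
        by_cases h : k < i
        · rw [hmono i h, zero_mul]
        · rw [hb.2 l (by omega), iterate_map_zero, mul_zero]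
    obtain ⟨w, r, hw, hr⟩ := ih _ hlt
    refine ⟨w + monomial k c, r, ?_, hr⟩
    rw [add_mul, add_right_comm, ← hw, sub_add_cancel]

lemma HasDegree.le_of_mul {p q : SkewPolynomial F} {b n : ℕ} (hq : HasDegree q b)
    (h : HasDegree (p * q) n) : b ≤ n ∧ HasDegree p (n - b) := by
  have hp : p ≠ 0 := by
    rintro rfl
    exact h.ne_zero (zero_mul q)
  obtain ⟨a, ha⟩ := exists_hasDegree hp
  obtain rfl := (ha.mul hq).unique h
  exact ⟨by omega, by simpa using ha⟩

/-- This gives uniqueness of remainders: two polynomials of degree below `n` that are congruent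
modulo `R b` coincide. -/
lemma eq_zero_of_mul_degreeLT {w b : SkewPolynomial F} {n : ℕ} (hb : HasDegree b n)
    (h : DegreeLT (w * b) n) : w = 0 := by
  by_contra hw
  obtain ⟨k, hk⟩ := exists_hasDegree hw
  have := (hk.mul hb).lt_of_degreeLT h
  omega

/-- Every left ideal of `F[X; θ]` is principal. -/
lemma exists_span_singleton (I : Submodule (SkewPolynomial F) (SkewPolynomial F)) :
    ∃ b ∈ I, ∀ x ∈ I, ∃ w, x = w * b := by
  classical
  by_cases hI : ∃ n, ∃ b ∈ I, HasDegree b n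
  · obtain ⟨b, hbI, hb⟩ := Nat.find_spec hI
    refine ⟨b, hbI, fun x hx => ?_⟩
    obtain ⟨w, r, rfl, hr⟩ := exists_eq_mul_add hb x
    refine ⟨w, ?_⟩
    by_contra hne
    have hr0 : r ≠ 0 := by
      rintro rfl
      exact hne (add_zero _)
    obtain ⟨k, hk⟩ := exists_hasDegree hr0
    have hrI : r ∈ I := by
      have := I.sub_mem hx (I.smul_mem w hbI)
      rwa [smul_eq_mul, add_sub_cancel_left] at this
    exact absurd (Nat.find_min' hI ⟨r, hrI, hk⟩) (not_le.2 (hk.lt_of_degreeLT hr))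
  · refine ⟨0, I.zero_mem, fun x hx => ⟨0, ?_⟩⟩
    by_contra hne
    rw [mul_zero] at hne
    obtain ⟨n, hn⟩ := exists_hasDegree hne
    exact hI ⟨n, x, hx, hn⟩

lemma coeff_X_pow (n j : ℕ) : (X ^ n : SkewPolynomial F).coeff j = if n = j then 1 else 0 := by
  rw [← monomial_one_right_eq_X_pow, coeff_monomial]

lemma coeff_X_pow_sub_one (n j : ℕ) : (X ^ n - 1 : SkewPolynomial F).coeff j =
    (if n = j then 1 else 0) - if 0 = j then 1 else 0 := by
  rw [coeff_sub, coeff_X_pow, coeff_one]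

lemma hasDegree_X_pow_sub_one {n : ℕ} (hn : 0 < n) :
    HasDegree (X ^ n - 1 : SkewPolynomial F) n := by
  refine ⟨?_, fun j hj => ?_⟩
  · rw [coeff_X_pow_sub_one, if_pos rfl, if_neg hn.ne, sub_zero]
    exact one_ne_zero
  · rw [coeff_X_pow_sub_one, if_neg hj.ne, if_neg (by omega), sub_zero]

lemma smul_eq_C_mul (c : F) (p : SkewPolynomial F) : c • p = C c * p := by
  induction p using induction_monomial with
  | zero => simp
  | add p q hp hq => rw [smul_add, hp, hq, mul_add]
  | mono n d => rw [C_mul_monomial, smul_monomial, smul_eq_mul]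

lemma monomial_mul_eq_smul (n : ℕ) (c : F) (p : SkewPolynomial F) :
    monomial n c * p = c • (X ^ n * p) := by
  rw [smul_eq_C_mul, ← mul_assoc, C_mul_X_pow_eq_monomial]

lemma X_pow_mul_comm {m : ℕ} (hm : ∀ c : F, φ^[m] c = c) (p : SkewPolynomial F) :
    X ^ m * p = p * X ^ m := by
  rw [X_pow_mul]
  simp only [hm, sum_monomial]

/-- If `φ ^ m = 1`, then `X ^ m - 1` is central, so its factorizations commute. -/
lemma mul_comm_of_eq_X_pow_sub_one {m : ℕ} (hm0 : 0 < m) (hm : ∀ c : F, φ^[m] c = c)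
    {p q : SkewPolynomial F} (h : X ^ m - 1 = p * q) : X ^ m - 1 = q * p := by
  have hz : p * q ≠ 0 := h ▸ (hasDegree_X_pow_sub_one hm0).ne_zero
  have hp : p ≠ 0 := left_ne_zero_of_mul hz
  -- After multiplying by `p` on the left, associativity gives `p (q p) = (p q) p = (X ^ m - 1) p`,
  -- and centrality moves `p` to the front.
  apply mul_left_cancel₀ hp
  rw [← mul_assoc, ← h, mul_sub, sub_mul, X_pow_mul_comm hm, mul_one, one_mul]

end SkewPolynomial

end

/-! ### Coefficient vectors modulo `X ^ m - 1` and the Euclidean form on them. -/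

noncomputable section

namespace SemilinearCodes

open Matrix SkewPolynomial Multiplicative

variable {F : Type*} [Field F]

lemma semilin_add {ι : Type*} [Fintype ι] (θ : F ≃+* F) (M : Matrix ι ι F) (v w : ι → F) :
    semilin θ M (v + w) = semilin θ M v + semilin θ M w := by
  unfold semilin
  rw [← add_vecMul]
  congr 1
  ext j
  simp

lemma semilin_zero {ι : Type*} [Fintype ι] (θ : F ≃+* F) (M : Matrix ι ι F) :
    semilin θ M 0 = 0 := by
  have h := semilin_add θ M 0 0
  rwa [add_zero, left_eq_add] at h

/-- The coefficient vector of the residue class of a skew polynomial modulo `X ^ m - 1`. -/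
def cyclicCoeff (F : Type*) [Field F] (m : ℕ) [NeZero m] : SkewPolynomial F →ₗ[F] (Fin m → F) :=
  (Finsupp.lsum F fun j : Multiplicative ℕ =>
    LinearMap.single F (fun _ : Fin m => F) (Fin.ofNat m (toAdd j))) ∘ₗ
    (SkewMonoidAlgebra.coeffLinearEquiv (S := F) (k := F) (G := Multiplicative ℕ)).toLinearMap

section cyclic

variable {m : ℕ} [NeZero m]

lemma cyclicCoeff_monomial (n : ℕ) (c : F) :
    cyclicCoeff F m (monomial n c) = Pi.single (Fin.ofNat m n) c := by
  simp [cyclicCoeff, monomial_def, SkewMonoidAlgebra.coeffLinearEquiv,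
    SkewMonoidAlgebra.coeffAddEquiv]

lemma cyclicCoeff_of_degreeLT {p : SkewPolynomial F} (hp : DegreeLT p m) :
    cyclicCoeff F m p = fun j : Fin m => p.coeff j := by
  conv_lhs => rw [hp.eq_sum]
  ext t
  rw [map_sum, Finset.sum_apply, Finset.sum_eq_single (t : ℕ)]
  · rw [cyclicCoeff_monomial, Fin.ofNat_val_eq_self, Pi.single_eq_same]
  · intro j hj hne
    rw [Finset.mem_range] at hj
    rw [cyclicCoeff_monomial, Pi.single_eq_of_ne]
    rintro rfl
    exact hne (by simp [Nat.mod_eq_of_lt hj])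
  · intro h
    exact absurd (Finset.mem_range.2 t.2) h

lemma ofNat_eq_ofNat_iff {i j : ℕ} : Fin.ofNat m i = Fin.ofNat m j ↔ i ≡ j [MOD m] := by
  rw [Fin.ext_iff]
  rfl

lemma single_dotProduct_cyclic (i j : ℕ) (a b : F) :
    (Pi.single (Fin.ofNat m i) a : Fin m → F) ⬝ᵥ Pi.single (Fin.ofNat m j) b =
      if i ≡ j [MOD m] then a * b else 0 := by
  classical
  rw [single_dotProduct, Pi.single_apply]
  simp only [ofNat_eq_ofNat_iff, mul_ite, mul_zero]

variable [MulSemiringAction (Multiplicative ℕ) F]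

lemma cyclicCoeff_mul_X_pow (p : SkewPolynomial F) :
    cyclicCoeff F m (p * X ^ m) = cyclicCoeff F m p := by
  induction p using induction_monomial with
  | zero => simp
  | add p q hp hq => rw [add_mul, map_add, hp, hq, map_add]
  | mono n c =>
    rw [monomial_mul_X_pow, cyclicCoeff_monomial, cyclicCoeff_monomial]
    congr 1
    rw [ofNat_eq_ofNat_iff]
    simp [Nat.ModEq]

/-- The map factors through the quotient by the left ideal `R (X ^ m - 1)`. No condition on the
order of `θ` is needed, since `X ^ m` stands on the right and twists no coefficient. -/
lemma cyclicCoeff_mul_X_pow_sub_one (p : SkewPolynomial F) :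
    cyclicCoeff F m (p * (X ^ m - 1)) = 0 := by
  rw [mul_sub, map_sub, cyclicCoeff_mul_X_pow, mul_one, sub_self]

variable {θ : F ≃+* F}

/-- On monomials `X` twists the coefficient and shifts the exponent modulo `m`; the wrap-around is
the last row of the cyclic matrix. -/
lemma cyclicCoeff_X_mul (hθ : ∀ x : F, ofAdd 1 • x = θ x) (p : SkewPolynomial F) :
    cyclicCoeff F m (X * p) = semilin θ (cyclicMatrix F m) (cyclicCoeff F m p) := by
  induction p using induction_monomial with
  | zero => rw [mul_zero, map_zero, semilin_zero]
  | add p q hp hq => rw [mul_add, map_add, hp, hq, map_add, semilin_add]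
  | mono n c =>
    rw [X_mul_monomial, cyclicCoeff_monomial, cyclicCoeff_monomial, semilin]
    have hφ : (φ : F →+* F) c = θ c := hθ c
    have h1 : (fun j => θ ((Pi.single (Fin.ofNat m n) c : Fin m → F) j)) =
        Pi.single (Fin.ofNat m n) (θ c) := by
      ext j
      by_cases h : j = Fin.ofNat m n
      · subst h; simp
      · rw [Pi.single_eq_of_ne h, Pi.single_eq_of_ne h, map_zero]
    rw [h1, hφ]
    ext j
    rw [single_vecMul, Pi.smul_apply, smul_eq_mul, cyclicMatrix, companion, row_apply, of_apply]
    have hj := j.2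
    have hn : n % m < m := Nat.mod_lt n (NeZero.pos m)
    have hv : ((Fin.ofNat m n : Fin m) : ℕ) = n % m := rfl
    have hsucc : (n + 1) % m = if n % m + 1 = m then 0 else n % m + 1 := by
      rw [Nat.add_mod_eq_add_mod_right 1 (Nat.mod_mod n m).symm]
      split_ifs with h
      · rw [h, Nat.mod_self]
      · exact Nat.mod_eq_of_lt (by omega)
    rw [hv, Pi.single_apply]
    have hiff : j = Fin.ofNat m (n + 1) ↔ (j : ℕ) = (n + 1) % m := by
      rw [Fin.ext_iff]
      rfl
    simp only [hiff, hsucc]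
    split_ifs <;> simp

lemma cyclicCoeff_X_pow_mul (hθ : ∀ x : F, ofAdd 1 • x = θ x) (k : ℕ) (p : SkewPolynomial F) :
    cyclicCoeff F m (X ^ k * p) = (semilin θ (cyclicMatrix F m))^[k] (cyclicCoeff F m p) := by
  induction k with
  | zero => simp
  | succ k ih => 
    rw [Function.iterate_succ_apply', ← ih, ← cyclicCoeff_X_mul hθ, pow_succ', mul_assoc]

/-- Multiplication by `X` acts on the Euclidean scalar product through the automorphism. -/
lemma cyclicCoeff_X_mul_dotProduct (p q : SkewPolynomial F) :
    cyclicCoeff F m (X * p) ⬝ᵥ cyclicCoeff F m (X * q) =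
      φ (cyclicCoeff F m p ⬝ᵥ cyclicCoeff F m q) := by
  induction p using induction_monomial with
  | zero => simp
  | add p p' hp hp' => simp only [mul_add, map_add, add_dotProduct, hp, hp']
  | mono i c =>
    induction q using induction_monomial with
    | zero => simp
    | add q q' hq hq' => simp only [mul_add, map_add, dotProduct_add, hq, hq']
    | mono j d =>
      rw [X_mul_monomial, X_mul_monomial]
      simp only [cyclicCoeff_monomial, single_dotProduct_cyclic]
      have : i + 1 ≡ j + 1 [MOD m] ↔ i ≡ j [MOD m] :=
        ⟨Nat.ModEq.add_right_cancel' 1, Nat.ModEq.add_right 1⟩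
      simp only [this]
      split_ifs <;> simp

lemma cyclicCoeff_X_pow_mul_dotProduct (k : ℕ) (p q : SkewPolynomial F) :
    cyclicCoeff F m (X ^ k * p) ⬝ᵥ cyclicCoeff F m (X ^ k * q) =
      φ^[k] (cyclicCoeff F m p ⬝ᵥ cyclicCoeff F m q) := by
  induction k with
  | zero => simp
  | succ k ih =>
    rw [Function.iterate_succ_apply', ← ih, ← cyclicCoeff_X_mul_dotProduct]
    simp only [pow_succ', mul_assoc]

end cyclic

end SemilinearCodes

end

/-! ### The polynomial `h^⊥` and Euclidean duals modulo `X ^ m - 1`. -/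

noncomputable section

namespace SemilinearCodes

open Matrix SkewPolynomial Multiplicative

variable {F : Type*} [Field F] {θ : F ≃+* F}

lemma coeff_hPerp (k : ℕ) (h : SkewPolynomial F) (j : ℕ) :
    (hPerp θ k h).coeff j = if j ≤ k then θ^[j] (h.coeff (k - j)) else 0 := by
  simp only [hPerp, coeff_finsetSum, coeff_monomial, Finset.sum_ite_eq', Finset.mem_range,
    Nat.lt_succ_iff]

variable [MulSemiringAction (Multiplicative ℕ) F]

lemma φ_iterate_eq (hθ : ∀ x : F, ofAdd 1 • x = θ x) (n : ℕ) (c : F) : φ^[n] c = θ^[n] c := by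
  have : (φ : F → F) = θ := funext hθ
  rw [this]

lemma φ_iterate_congr {m : ℕ} (hm : ∀ c : F, φ^[m] c = c) {i j : ℕ} (h : i ≡ j [MOD m])
    (c : F) : φ^[i] c = φ^[j] c := by
  have hmul : ∀ t : ℕ, (φ : F → F)^[m * t] = id := fun t => by
    rw [Function.iterate_mul, show (φ : F → F)^[m] = id from funext hm, Function.iterate_id]
  have hmod : ∀ n : ℕ, φ^[n] c = φ^[n % m] c := fun n => by
    conv_lhs => rw [← Nat.mod_add_div n m, Function.iterate_add_apply, hmul, id]
  rw [hmod i, hmod j, h]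

/-- The leading coefficient is `θ^k (h₀)`. A nonzero constant term of `h` therefore makes division
by `h^⊥` possible. -/
lemma hasDegree_hPerp (hθ : ∀ x : F, ofAdd 1 • x = θ x) {k : ℕ} {h : SkewPolynomial F}
    (h0 : h.coeff 0 ≠ 0) : HasDegree (hPerp θ k h) k := by
  refine ⟨?_, fun j hj => by rw [coeff_hPerp, if_neg (by omega)]⟩
  rw [coeff_hPerp, if_pos le_rfl, Nat.sub_self, ← φ_iterate_eq hθ]
  exact φ_iterate_ne_zero h0 k

section

variable {m : ℕ} [NeZero m]

/-- Scalar products with shifts of `h^⊥` are coefficients of products with `h`. -/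
lemma X_pow_mul_hPerp_dotProduct (hθ : ∀ x : F, ofAdd 1 • x = θ x) (hm : ∀ c : F, φ^[m] c = c)
    {k : ℕ} {h : SkewPolynomial F} (hh : DegreeLT h (k + 1)) (s : ℕ) (p : SkewPolynomial F) :
    cyclicCoeff F m (X ^ s * hPerp θ k h) ⬝ᵥ cyclicCoeff F m p =
      cyclicCoeff F m (p * h) (Fin.ofNat m (k + s)) := by
  induction p using induction_monomial with
  | zero => simp
  | add p q hp hq => rw [map_add, dotProduct_add, hp, hq, add_mul, map_add, Pi.add_apply]
  | mono i c =>
    have hR : cyclicCoeff F m (monomial i c * h) (Fin.ofNat m (k + s)) =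
        ∑ l ∈ Finset.range (k + 1),
          if k + s ≡ i + l [MOD m] then c * φ^[i] (h.coeff l) else 0 := by
      conv_lhs => rw [hh.eq_sum]
      simp only [Finset.mul_sum, map_sum, Finset.sum_apply, monomial_mul_monomial,
        cyclicCoeff_monomial, Pi.single_apply, ofNat_eq_ofNat_iff]
    -- The coefficients of `h^⊥` are those of `h` in reverse order, so the index `l` is matched with
    -- `k - j`.
    rw [hR, ← Finset.sum_flip]
    simp only [hPerp, Finset.mul_sum, map_sum, X_pow_mul_monomial, cyclicCoeff_monomial,
      sum_dotProduct, single_dotProduct_cyclic]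
    refine Finset.sum_congr rfl fun j hj => ?_
    rw [Finset.mem_range] at hj
    have hiff : j + s ≡ i [MOD m] ↔ k + s ≡ i + (k - j) [MOD m] := by
      have e : k + s = (j + s) + (k - j) := by omega
      rw [e]
      exact ⟨Nat.ModEq.add_right _, Nat.ModEq.add_right_cancel' _⟩
    -- The left side carries the twist `φ^(s + j)` and the right side `φ^i`. They agree exactly
    -- because the exponents are congruent modulo `m` and `φ^m = 1`.
    by_cases hc : j + s ≡ i [MOD m]
    · rw [if_pos hc, if_pos (hiff.1 hc), ← φ_iterate_eq hθ, ← Function.iterate_add_apply,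
        add_comm s j, φ_iterate_congr hm hc, mul_comm]
    · rw [if_neg hc, if_neg (mt hiff.2 hc)]

lemma cyclicCoeff_X_pow_mul_period (hm : ∀ c : F, φ^[m] c = c) (t : ℕ) (p : SkewPolynomial F) :
    cyclicCoeff F m (X ^ (m * t) * p) = cyclicCoeff F m p := by
  induction t with
  | zero => simp
  | succ t ih =>
    rw [Nat.mul_succ, add_comm, pow_add, mul_assoc, X_pow_mul_comm hm, cyclicCoeff_mul_X_pow, ih]

/-- If `X ^ m - 1 = g h = h g`, then the Euclidean dual of `R g / R (X ^ m - 1)` is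
`R h^⊥ / R (X ^ m - 1)`. -/
lemma orthogonal_iff_exists_mul_hPerp (hθ : ∀ x : F, ofAdd 1 • x = θ x)
    (hm : ∀ c : F, φ^[m] c = c) {k : ℕ} {g h : SkewPolynomial F} (hh : HasDegree h k)
    (hgh : X ^ m - 1 = g * h) (x : SkewPolynomial F) :
    (∀ y, cyclicCoeff F m x ⬝ᵥ cyclicCoeff F m (y * g) = 0) ↔ ∃ w, x = w * hPerp θ k h := by
  have hm0 : 0 < m := NeZero.pos m
  have hg : g ≠ 0 := by
    rintro rfl
    exact (hasDegree_X_pow_sub_one hm0).ne_zero (by rw [hgh, zero_mul])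
  have h0 : h.coeff 0 ≠ 0 := by
    intro hc
    have := congrArg (fun p => SkewPolynomial.coeff p 0) hgh
    simp only [coeff_X_pow_sub_one, coeff_mul_zero, hc, mul_zero, if_neg hm0.ne', if_pos] at this
    simp at this
  have hz := hgh ▸ hasDegree_X_pow_sub_one (F := F) hm0
  obtain ⟨hkm, hgd⟩ := hh.le_of_mul hz
  have hdual : ∀ w y, cyclicCoeff F m (w * hPerp θ k h) ⬝ᵥ cyclicCoeff F m (y * g) = 0 := by
    intro w y
    induction w using induction_monomial with
    | zero => simp
    | add p q hp hq => rw [add_mul, map_add, add_dotProduct, hp, hq, add_zero]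
    | mono s c =>
      induction y using induction_monomial with
      | zero => simp
      | add p q hp hq => rw [add_mul, map_add, dotProduct_add, hp, hq, add_zero]
      | mono t d =>
        rw [monomial_mul_eq_smul, monomial_mul_eq_smul, map_smul, map_smul, smul_dotProduct,
          dotProduct_smul]
        -- Multiplying the left argument by `X ^ (m * t)` does not change its coefficient vector. It
        -- supplies a factor `X ^ t` on both sides, which leaves the scalar product as `φ^t`. What
        -- remains is a coefficient of `g * h = X ^ m - 1`, which vanishes modulo `X ^ m - 1`.
        have e : X ^ (m * t) * (X ^ s * hPerp θ k h) =
            X ^ t * (X ^ ((m - 1) * t + s) * hPerp θ k h) := by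
          rw [← mul_assoc, ← mul_assoc, ← pow_add, ← pow_add]
          congr 2
          obtain ⟨m', rfl⟩ : ∃ m', m = m' + 1 := ⟨m - 1, by omega⟩
          simp only [Nat.add_sub_cancel]
          ring
        rw [← cyclicCoeff_X_pow_mul_period hm t, e, cyclicCoeff_X_pow_mul_dotProduct,
          X_pow_mul_hPerp_dotProduct hθ hm (hh.degreeLT (Nat.lt_succ_self k)), ← hgh,
          ← one_mul (X ^ m - 1), cyclicCoeff_mul_X_pow_sub_one, Pi.zero_apply, iterate_map_zero,
          smul_zero, smul_zero]
  constructor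
  · intro hx
    -- No dimension count is used: the remainder `r` of degree below `k` is itself orthogonal to `R
    -- g`, and this forces its coefficients to vanish one after another.
    obtain ⟨w, r, rfl, hr⟩ := exists_eq_mul_add (hasDegree_hPerp (k := k) hθ h0) x
    have hr' : ∀ y, cyclicCoeff F m r ⬝ᵥ cyclicCoeff F m (y * g) = 0 := fun y => by
      have := hx y
      rwa [map_add, add_dotProduct, hdual, zero_add] at this
    refine ⟨w, ?_⟩
    suffices hr0 : ∀ i, i < k → r.coeff i = 0 by
      have : r = 0 := by
        ext i
        by_cases hi : i < k
        · rw [hr0 i hi, coeff_zero]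
        · rw [hr i (by omega), coeff_zero]
      rw [this, add_zero]
    intro i
    induction i using Nat.strong_induction_on with
    | _ i ih =>
      intro hik
      -- Since `g` has degree `m - k`, the leading term of `X ^ (k + i) * g` wraps around to
      -- position `i`. Every other term lands either at a position `≥ k`, where `r` vanishes by
      -- degree, or below `i`, where it vanishes by induction.
      have hsum := hr' (X ^ (k + i))
      rw [(hgd.degreeLT (Nat.lt_succ_self (m - k))).eq_sum,
        cyclicCoeff_of_degreeLT (hr.mono hkm)] at hsum
      simp only [Finset.mul_sum, map_sum, X_pow_mul_monomial, cyclicCoeff_monomial,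
        dotProduct_sum, dotProduct_single, Fin.ofNat] at hsum
      rw [Finset.sum_eq_single (m - k)] at hsum
      · have hmod : (m - k + (k + i)) % m = i := by
          rw [show m - k + (k + i) = m + i by omega, Nat.add_mod_left, Nat.mod_eq_of_lt (by omega)]
        rw [hmod] at hsum
        exact (mul_eq_zero.1 hsum).resolve_right (φ_iterate_ne_zero hgd.1 _)
      · intro j hj hne
        rw [Finset.mem_range] at hj
        by_cases hlt : j + (k + i) < m
        · rw [Nat.mod_eq_of_lt hlt, hr _ (by omega), zero_mul]
        · have hmod : (j + (k + i)) % m = j + (k + i) - m := by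
            rw [Nat.mod_eq_sub_mod (by omega), Nat.mod_eq_of_lt (by omega)]
          rw [hmod, ih _ (by omega) (by omega), zero_mul]
      · intro hn
        exact absurd (Finset.mem_range.2 (Nat.lt_succ_self (m - k))) hn
  · rintro ⟨w, rfl⟩ y
    exact hdual w y

end

end SemilinearCodes

end

/-! ### Module codes, companion matrices and generator matrices. -/

noncomputable section

namespace SemilinearCodes

open Matrix SkewPolynomial Multiplicative

variable {F : Type*} [Field F] {θ : F ≃+* F} {n : ℕ}

lemma coeff_toPoly (c : Fin n → F) (j : ℕ) :
    (toPoly c).coeff j = if h : j < n then c ⟨j, h⟩ else 0 := by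
  simp only [toPoly, coeff_finsetSum, coeff_monomial]
  split_ifs with h
  · rw [Finset.sum_eq_single (⟨j, h⟩ : Fin n)]
    · simp
    · intro i _ hi
      exact if_neg fun hc => hi (Fin.ext hc)
    · simp
  · exact Finset.sum_eq_zero fun i _ => if_neg fun hc => h (by rw [← hc]; exact i.2)

lemma coeff_toPoly_fin (c : Fin n → F) (j : Fin n) : (toPoly c).coeff j = c j := by
  rw [coeff_toPoly, dif_pos j.2]

lemma degreeLT_toPoly (c : Fin n → F) : DegreeLT (toPoly c) n :=
  fun j hj => by rw [coeff_toPoly, dif_neg (by omega)]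

lemma toPoly_injective : Function.Injective (toPoly : (Fin n → F) → SkewPolynomial F) :=
  fun c d h => funext fun j => by rw [← coeff_toPoly_fin c, h, coeff_toPoly_fin]

lemma toPoly_coeff {p : SkewPolynomial F} (hp : DegreeLT p n) :
    toPoly (fun j : Fin n => p.coeff j) = p := by
  ext j
  rw [coeff_toPoly]
  split_ifs with h
  · rfl
  · exact (hp j (by omega)).symm

lemma toPoly_zero : toPoly (0 : Fin n → F) = 0 := by
  simp [toPoly]

lemma toPoly_sum_smul {ι : Type*} (s : Finset ι) (c : ι → F) (v : ι → Fin n → F) :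
    toPoly (∑ i ∈ s, c i • v i) = ∑ i ∈ s, c i • toPoly (v i) := by
  ext j
  simp only [coeff_finsetSum, coeff_smul, coeff_toPoly]
  split_ifs
  · simp
  · simp

lemma IsGeneratorMatrix.finrank_eq {ι : Type*} {s : ℕ} {G : Matrix (Fin s) ι F}
    {𝒞 : Submodule F (ι → F)} (h : IsGeneratorMatrix G 𝒞) : Module.finrank F 𝒞 = s := by
  rw [← h.2, finrank_span_eq_card h.1, Fintype.card_fin]

variable [MulSemiringAction (Multiplicative ℕ) F]

lemma toPoly_mul (c : Fin n → F) (p : SkewPolynomial F) :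
    toPoly c * p = ∑ k : Fin n, c k • (X ^ (k : ℕ) * p) := by
  simp only [toPoly, Finset.sum_mul, monomial_mul_eq_smul]

lemma mkQ_leftIdeal_eq_iff {f p q : SkewPolynomial F} :
    (leftIdeal f).mkQ p = (leftIdeal f).mkQ q ↔ ∃ w, p = w * f + q := by
  rw [Submodule.mkQ_apply, Submodule.mkQ_apply, Submodule.Quotient.eq, leftIdeal,
    Submodule.mem_span_singleton]
  simp only [smul_eq_mul, eq_sub_iff_add_eq, eq_comm]

lemma toQuot_mem_map_iff {f g p : SkewPolynomial F} (hf : f = p * g) (c : Fin n → F) :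
    toQuot f c ∈ (leftIdeal g).map (leftIdeal f).mkQ ↔ ∃ w, toPoly c = w * g := by
  rw [toQuot, Submodule.mem_map]
  constructor
  · rintro ⟨y, hy, hyc⟩
    obtain ⟨v, rfl⟩ := Submodule.mem_span_singleton.1 hy
    obtain ⟨w, hw⟩ := mkQ_leftIdeal_eq_iff.1 hyc.symm
    exact ⟨w * p + v, by rw [hw, hf, smul_eq_mul, add_mul, mul_assoc]⟩
  · rintro ⟨w, hw⟩
    exact ⟨w * g, Submodule.mem_span_singleton.2 ⟨w, rfl⟩, by rw [hw]⟩

lemma isModuleCodeGenBy_iff {f g : SkewPolynomial F} {𝒞 : Submodule F (Fin n → F)} :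
    IsModuleCodeGenBy f g 𝒞 ↔ (∃ p, f = p * g) ∧ ∀ c, c ∈ 𝒞 ↔ ∃ w, toPoly c = w * g := by
  refine and_congr_right fun ⟨p, hp⟩ => forall_congr' fun c => ?_
  rw [toQuot_mem_map_iff hp]

lemma skewCharPoly_eq_smul (a : Fin n → F) :
    skewCharPoly a = ((-1 : F) ^ n) • (X ^ n - toPoly a) := by
  rw [skewCharPoly, smul_eq_C_mul, C_pow, C_neg, C_1]

lemma coeff_skewCharPoly (a : Fin n → F) (j : ℕ) : (skewCharPoly a).coeff j =
    (-1) ^ n * ((if n = j then 1 else 0) - if h : j < n then a ⟨j, h⟩ else 0) := by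
  rw [skewCharPoly_eq_smul, coeff_smul, coeff_sub, coeff_X_pow, coeff_toPoly]

lemma hasDegree_skewCharPoly (a : Fin n → F) : HasDegree (skewCharPoly a) n := by
  refine ⟨?_, fun j hj => ?_⟩
  · rw [coeff_skewCharPoly, if_pos rfl, dif_neg (lt_irrefl n), sub_zero, mul_one]
    exact pow_ne_zero _ (neg_ne_zero.2 one_ne_zero)
  · rw [coeff_skewCharPoly, if_neg hj.ne, dif_neg (by omega), sub_zero, mul_zero]

lemma coeff_zero_skewCharPoly_ne_zero {a : Fin n → F} (hn : 0 < n) (ha : a ⟨0, hn⟩ ≠ 0) :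
    (skewCharPoly a).coeff 0 ≠ 0 := by
  rw [coeff_skewCharPoly, if_neg hn.ne', dif_pos hn, zero_sub]
  exact mul_ne_zero (pow_ne_zero _ (neg_ne_zero.2 one_ne_zero)) (neg_ne_zero.2 ha)

/-- The semi-linear map of a companion matrix is multiplication by `X` modulo `f`. -/
lemma toPoly_semilin_companion (hθ : ∀ x : F, ofAdd 1 • x = θ x) (a v : Fin n → F) :
    ∃ w, toPoly (semilin θ (companion a) v) = w * skewCharPoly a + X * toPoly v := by
  obtain _ | n := n
  · refine ⟨0, ?_⟩
    rw [zero_mul, zero_add, Subsingleton.elim v 0,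
      Subsingleton.elim (semilin θ (companion a) 0) 0, toPoly_zero, mul_zero]
  have hφ : ∀ c : F, (φ : F →+* F) c = θ c := hθ
  set t := θ (v (Fin.last n)) with ht
  have hs : X * toPoly v = ∑ j : Fin (n + 1), monomial ((j : ℕ) + 1) (θ (v j)) := by
    simp only [toPoly, Finset.mul_sum, X_mul_monomial, hφ]
  -- The term `t X^(n+1)` of `X v` has to be replaced by `t` times `toPoly a`. The sign undoes the
  -- factor `(-1)^(n+1)` in `skewCharPoly a`.
  refine ⟨C (-(t * (-1) ^ (n + 1))), ?_⟩
  have hone : (-1 : F) ^ (n + 1) * (-1) ^ (n + 1) = 1 := by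
    rw [← mul_pow, neg_one_mul, neg_neg, one_pow]
  have hf : C (-(t * (-1) ^ (n + 1))) * skewCharPoly a = (-t) • (X ^ (n + 1) - toPoly a) := by
    rw [skewCharPoly_eq_smul, ← smul_eq_C_mul, smul_smul, neg_mul, mul_assoc, hone, mul_one]
  rw [hf, hs]
  ext j
  simp only [coeff_add, coeff_smul, coeff_sub, coeff_X_pow, coeff_toPoly, coeff_finsetSum,
    coeff_monomial, Fin.sum_univ_castSucc, Fin.val_castSucc, Fin.val_last]
  rw [← ht]
  by_cases hj : j < n + 1
  · rw [dif_pos hj, dif_pos hj, if_neg hj.ne', if_neg hj.ne']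
    have hc : semilin θ (companion a) v ⟨j, hj⟩ = (∑ i : Fin n,
        if (i : ℕ) + 1 = j then θ (v i.castSucc) else 0) + t * a ⟨j, hj⟩ := by
      rw [semilin, vecMul, dotProduct, Fin.sum_univ_castSucc, ht]
      congr 1
      · refine Finset.sum_congr rfl fun i _ => ?_
        have hi : (i : ℕ) + 1 ≠ n + 1 := by have := i.2; omega
        simp only [companion, of_apply, Fin.val_castSucc, if_neg hi, mul_ite, mul_one, mul_zero,
          eq_comm (a := j)]
      · simp [companion]
    rw [hc]
    ring
  · have hsum : (∑ i : Fin n, if (i : ℕ) + 1 = j then θ (v i.castSucc) else 0) = 0 :=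
      Finset.sum_eq_zero fun i _ => if_neg fun h => by have := i.2; omega
    rw [dif_neg hj, dif_neg hj, hsum]
    split_ifs <;> ring

lemma toPoly_iterate_semilin_companion (hθ : ∀ x : F, ofAdd 1 • x = θ x) (a v : Fin n → F)
    (k : ℕ) : ∃ w, toPoly ((semilin θ (companion a))^[k] v) =
      w * skewCharPoly a + X ^ k * toPoly v := by
  induction k with
  | zero => exact ⟨0, by simp⟩
  | succ k ih =>
    obtain ⟨w, hw⟩ := ih
    obtain ⟨w', hw'⟩ := toPoly_semilin_companion hθ a ((semilin θ (companion a))^[k] v)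
    refine ⟨w' + X * w, ?_⟩
    rw [Function.iterate_succ_apply', hw', hw, pow_succ']
    simp only [mul_add, add_mul, mul_assoc, add_assoc]

/-- A module code is invariant under the semi-linear map of the companion matrix. -/
lemma IsModuleCode.isTCode (hθ : ∀ x : F, ofAdd 1 • x = θ x) {a : Fin n → F}
    {𝒞 : Submodule F (Fin n → F)} (h : IsModuleCode (skewCharPoly a) 𝒞) :
    IsTCode θ (companion a) 𝒞 := by
  obtain ⟨g, hg⟩ := h
  obtain ⟨⟨p, hp⟩, hg⟩ := isModuleCodeGenBy_iff.1 hg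
  intro v hv
  obtain ⟨w, hw⟩ := (hg v).1 hv
  obtain ⟨w', hw'⟩ := toPoly_semilin_companion hθ a v
  exact (hg _).2 ⟨w' * p + X * w, by rw [hw', hw, hp, add_mul, mul_assoc, mul_assoc]⟩

/-- The shifts of a generating polynomial form a generator matrix of a module code. -/
lemma IsModuleCodeGenBy.isGeneratorMatrix (hθ : ∀ x : F, ofAdd 1 • x = θ x) {a u : Fin n → F}
    {p g : SkewPolynomial F} {𝒞 : Submodule F (Fin n → F)} {s : ℕ}
    (h𝒞 : IsModuleCodeGenBy (skewCharPoly a) g 𝒞) (hf : skewCharPoly a = p * g)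
    (hp : HasDegree p s) (hu : toQuot (skewCharPoly a) u = (leftIdeal (skewCharPoly a)).mkQ g) :
    IsGeneratorMatrix (orbitMatrix θ (companion a) u s) 𝒞 := by
  have hfd := hasDegree_skewCharPoly a
  have hg0 : g ≠ 0 := by
    rintro rfl
    exact hfd.ne_zero (by rw [hf, mul_zero])
  obtain ⟨e, he⟩ := exists_hasDegree hg0
  have hse : s + e = n := (hp.mul he).unique (hf ▸ hfd)
  have h𝒞 := (isModuleCodeGenBy_iff.1 h𝒞).2
  set row : Fin s → Fin n → F := fun k => (semilin θ (companion a))^[(k : ℕ)] u with hrdef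
  change LinearIndependent F row ∧ Submodule.span F (Set.range row) = 𝒞
  have hrow : ∀ k : Fin s, toPoly (row k) = X ^ (k : ℕ) * g := by
    intro k
    obtain ⟨w, hw⟩ := toPoly_iterate_semilin_companion hθ a u k
    obtain ⟨w', hw'⟩ := mkQ_leftIdeal_eq_iff.1 hu
    have hXk : HasDegree (X ^ (k : ℕ) : SkewPolynomial F) k :=
      ⟨by simp [coeff_X_pow], fun j hj => by rw [coeff_X_pow, if_neg hj.ne]⟩
    have hlt : DegreeLT (X ^ (k : ℕ) * g) n :=
      (hXk.mul he).degreeLT (by have := k.2; omega)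
    -- Both polynomials are congruent modulo `f` and have degree below `n`, the second because `k <
    -- s` and `s + e = n`; so they are equal, even when `g` is only represented by `u` modulo `f`.
    have heq : toPoly (row k) - X ^ (k : ℕ) * g =
        (w + X ^ (k : ℕ) * w') * skewCharPoly a := by
      rw [hrdef, hw, hw', mul_add, add_mul, mul_assoc, ← add_assoc,
        add_sub_cancel_right]
    have hz := eq_zero_of_mul_degreeLT hfd (heq ▸ (degreeLT_toPoly _).sub hlt)
    rw [hz, zero_mul] at heq
    exact sub_eq_zero.1 heq
  have hcomb : ∀ c : Fin s → F,
      toPoly (∑ k, c k • row k) = toPoly c * g := fun c => by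
    rw [toPoly_sum_smul, toPoly_mul]
    simp only [hrow]
  constructor
  · rw [Fintype.linearIndependent_iff]
    intro c hc
    have h0 := hcomb c
    rw [hc, toPoly_zero] at h0
    have : toPoly c = toPoly (0 : Fin s → F) := by
      rw [toPoly_zero]
      exact (mul_eq_zero.1 h0.symm).resolve_right hg0
    exact fun i => congrFun (toPoly_injective this) i
  · apply le_antisymm
    · rw [Submodule.span_le]
      rintro _ ⟨k, rfl⟩
      exact (h𝒞 _).2 ⟨_, hrow k⟩
    · intro v hv
      obtain ⟨w, hw⟩ := (h𝒞 v).1 hv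
      have hws : DegreeLT w s := by
        by_cases hw0 : w = 0
        · intro j _
          rw [hw0, coeff_zero]
        obtain ⟨k, hk⟩ := exists_hasDegree hw0
        have := (hk.mul he).lt_of_degreeLT (hw ▸ degreeLT_toPoly v)
        exact hk.degreeLT (by omega)
      rw [← toPoly_coeff hws, ← hcomb] at hw
      rw [toPoly_injective hw]
      exact Submodule.sum_mem _ fun k _ =>
        Submodule.smul_mem _ _ (Submodule.subset_span ⟨k, rfl⟩)

lemma exists_toQuot_eq (a : Fin n → F) (p : SkewPolynomial F) :
    ∃ u : Fin n → F, toQuot (skewCharPoly a) u = (leftIdeal (skewCharPoly a)).mkQ p := by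
  obtain ⟨w, r, hw, hr⟩ := exists_eq_mul_add (hasDegree_skewCharPoly a) p
  refine ⟨fun j => r.coeff j, ?_⟩
  rw [toQuot, toPoly_coeff hr, eq_comm, mkQ_leftIdeal_eq_iff]
  exact ⟨w, hw⟩

lemma IsModuleCodeGenBy.finrank_eq (hθ : ∀ x : F, ofAdd 1 • x = θ x) {a : Fin n → F}
    {p g : SkewPolynomial F} {𝒞 : Submodule F (Fin n → F)} {s : ℕ}
    (h𝒞 : IsModuleCodeGenBy (skewCharPoly a) g 𝒞) (hf : skewCharPoly a = p * g)
    (hp : HasDegree p s) : Module.finrank F 𝒞 = s := by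
  obtain ⟨u, hu⟩ := exists_toQuot_eq a g
  exact (h𝒞.isGeneratorMatrix hθ hf hp hu).finrank_eq

end SemilinearCodes

end

/-! ### The period of `f`, the matrix `Q` and the form `B = Q Qᵗ` on one block. -/

noncomputable section

namespace SemilinearCodes

open Matrix SkewPolynomial Multiplicative

variable {F : Type*} [Field F] {θ : F ≃+* F} {n : ℕ}

lemma dualWrt_eq_euclDual {ι : Type*} [Fintype ι] {B : Matrix ι ι F} (hB : Bᵀ = B)
    (𝒞 : Submodule F (ι → F)) : dualWrt B 𝒞 = euclDual (codeMul 𝒞 B) := by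
  ext x
  constructor
  · rintro hx _ ⟨c, hc, rfl⟩
    rw [vecMulLinear_apply, ← mulVec_transpose, hB, dotProduct_mulVec]
    exact hx c hc
  · intro hx c hc
    have := hx _ ⟨c, hc, rfl⟩
    rwa [vecMulLinear_apply, ← mulVec_transpose, hB, dotProduct_mulVec] at this

variable [MulSemiringAction (Multiplicative ℕ) F]

lemma φ_iterate_eq_self_of_dvd (hθ : ∀ x : F, ofAdd 1 • x = θ x) {m : ℕ}
    (h : orderOf (θ : RingAut F) ∣ m) (c : F) : φ^[m] c = c := by
  have hpow : ∀ k : ℕ, ∀ x : F, θ^[k] x = ((θ : RingAut F) ^ k) x := by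
    intro k
    induction k with
    | zero => intro x; rfl
    | succ k ih => intro x; rw [Function.iterate_succ_apply, ih, pow_succ, RingAut.mul_apply]
  rw [φ_iterate_eq hθ, hpow, orderOf_dvd_iff_pow_eq_one.1 h, RingAut.one_apply]

/-- Pulling `X` out on the left applies `θ⁻¹` to the coefficients, so bijectivity of `θ` enters
here. -/
lemma exists_X_mul_of_coeff_zero (hθ : ∀ x : F, ofAdd 1 • x = θ x) {p : SkewPolynomial F}
    (hp : p.coeff 0 = 0) : ∃ p', p = X * p' := by
  obtain ⟨N, hN⟩ := exists_degreeLT p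
  have hφ : ∀ c : F, (φ : F →+* F) c = θ c := hθ
  refine ⟨∑ j ∈ Finset.range N, monomial j (θ.symm (p.coeff (j + 1))), ?_⟩
  conv_lhs => rw [(hN.mono (Nat.le_succ N)).eq_sum]
  simp only [Finset.mul_sum, X_mul_monomial, hφ, RingEquiv.apply_symm_apply,
    Finset.sum_range_succ', hp, map_zero, add_zero]

/-- A polynomial with nonzero constant term is a right divisor of some `X ^ e - 1`. -/
lemma exists_X_pow_sub_one_eq_mul [Finite F] (hθ : ∀ x : F, ofAdd 1 • x = θ x)
    {f : SkewPolynomial F} (hf : HasDegree f n) (hf0 : f.coeff 0 ≠ 0) :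
    ∃ e, 0 < e ∧ ∃ p, X ^ e - 1 = p * f := by
  choose w r hw hr using fun i : ℕ => exists_eq_mul_add hf (X ^ i)
  -- There are only finitely many remainders modulo `f`, so two powers of `X` share one.
  obtain ⟨i, j, hij, hrij⟩ := Finite.exists_ne_map_eq_of_infinite
    fun i => (fun t : Fin n => (r i).coeff t)
  wlog hlt : j < i generalizing i j
  · exact this j i hij.symm hrij.symm (by omega)
  have hr_eq : r i = r j := by
    rw [← toPoly_coeff (hr i), ← toPoly_coeff (hr j)]
    exact congrArg toPoly hrij
  have hsub : X ^ j * (X ^ (i - j) - 1) = (w i - w j) * f := by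
    rw [mul_sub, mul_one, ← pow_add, Nat.add_sub_cancel' hlt.le, hw i, hw j, hr_eq, sub_mul,
      add_sub_add_right_eq_sub]
  refine ⟨i - j, by omega, ?_⟩
  generalize w i - w j = p at hsub
  clear hrij hij hr_eq
  -- Left factors `X` can be removed: as `f` has nonzero constant term, the constant term of `p`
  -- must vanish, so `p` is itself divisible by `X` on the left.
  have key : ∀ (k : ℕ) (y p : SkewPolynomial F), X ^ k * y = p * f → ∃ p, y = p * f := by
    intro k
    induction k with
    | zero => intro y p h; exact ⟨p, by rwa [pow_zero, one_mul] at h⟩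
    | succ k ih =>
      intro y p h
      have h0 : p.coeff 0 = 0 := by
        have := congrArg (fun q => SkewPolynomial.coeff q 0) h
        simp only [coeff_mul_zero, coeff_X_pow, if_neg (Nat.succ_ne_zero k), zero_mul] at this
        exact (mul_eq_zero.1 this.symm).resolve_right hf0
      obtain ⟨p', rfl⟩ := exists_X_mul_of_coeff_zero hθ h0
      rw [pow_succ', mul_assoc, mul_assoc] at h
      exact ih y p' (mul_left_cancel₀ X_ne_zero h)
  exact key j _ p hsub

/-- The pigeonhole argument makes `f` a right factor of `X ^ e - 1`, whereas the period needs a left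
factor. Multiplying `e` by the order of `θ` makes `X ^ (e * orderOf θ) - 1` central, and the factors
can be exchanged. -/
lemma exists_period [Finite F] (hθ : ∀ x : F, ofAdd 1 • x = θ x)
    {f : SkewPolynomial F} (hf : HasDegree f n) (hf0 : f.coeff 0 ≠ 0) :
    ∃ i, 0 < i ∧ ∃ p, X ^ i - 1 = f * p := by
  obtain ⟨e, he, p, hp⟩ := exists_X_pow_sub_one_eq_mul hθ hf hf0
  have : Finite (RingAut F) := Finite.of_injective (fun σ : RingAut F => (σ : F → F))
    DFunLike.coe_injective
  have ho : 0 < orderOf (θ : RingAut F) := orderOf_pos _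
  have hN : 0 < e * orderOf (θ : RingAut F) := Nat.mul_pos he ho
  refine ⟨_, hN, _, mul_comm_of_eq_X_pow_sub_one hN
    (φ_iterate_eq_self_of_dvd hθ (Nat.dvd_mul_left _ e))
    (p := (∑ i ∈ Finset.range (orderOf (θ : RingAut F)), (X ^ e) ^ i) * p) ?_⟩
  rw [pow_mul, ← geom_sum_mul, hp, mul_assoc]

lemma period_spec [Finite F] (hθ : ∀ x : F, ofAdd 1 • x = θ x)
    {f : SkewPolynomial F} (hf : HasDegree f n) (hf0 : f.coeff 0 ≠ 0) :
    0 < period f ∧ X ^ period f - 1 = f * cofactor f := by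
  have h : 0 < period f ∧ ∃ p, X ^ period f - 1 = f * p := Nat.sInf_mem (exists_period hθ hf hf0)
  exact ⟨h.1, Classical.epsilon_spec h.2⟩

/-- The matrix `Q` represents right multiplication by `q_f`. -/
lemma vecMul_matQ (hθ : ∀ x : F, ofAdd 1 • x = θ x) {f : SkewPolynomial F} [NeZero (period f)]
    (hq : DegreeLT (cofactor f) (period f)) (c : Fin n → F) :
    c ᵥ* matQ θ n f = cyclicCoeff F (period f) (toPoly c * cofactor f) := by
  rw [vecMul_eq_sum, toPoly_mul, map_sum]
  refine Finset.sum_congr rfl fun k _ => ?_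
  rw [map_smul, cyclicCoeff_X_pow_mul hθ, cyclicCoeff_of_degreeLT hq]
  rfl

/-- The form of `B = Q Qᵗ` is the Euclidean form pulled back along `Q`. -/
lemma mem_blockDual_iff {a : Fin n → F} {𝒞 : Submodule F (Fin n → F)} {x : Fin n → F} :
    x ∈ blockDual θ a 𝒞 ↔ ∀ c ∈ 𝒞,
      (x ᵥ* matQ θ n (skewCharPoly a)) ⬝ᵥ (c ᵥ* matQ θ n (skewCharPoly a)) = 0 := by
  refine forall₂_congr fun c _ => ?_
  rw [blockB, ← vecMul_vecMul, vecMul_transpose, dotProduct_comm, dotProduct_mulVec,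
    dotProduct_comm]

lemma blockB_transpose (a : Fin n → F) : (blockB θ a)ᵀ = blockB θ a := by
  rw [blockB, transpose_mul, transpose_transpose]

/-- Multiplication by `q_f` carries the quasi-Euclidean dual of `(g)` into the left ideal
generated by `h^⊥`, where `X ^ m - 1 = g q_f h`. -/
lemma mem_blockDual_iff_exists_mul_hPerp [Finite F] (hθ : ∀ x : F, ofAdd 1 • x = θ x)
    {a : Fin n → F} (hn : 0 < n) (ha : a ⟨0, hn⟩ ≠ 0)
    (hdvd : orderOf (θ : RingAut F) ∣ period (skewCharPoly a))
    {g h : SkewPolynomial F} {𝒞 : Submodule F (Fin n → F)} {k : ℕ}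
    (h𝒞 : IsModuleCodeGenBy (skewCharPoly a) g 𝒞) (hh : HasDegree h k)
    (hgh : X ^ period (skewCharPoly a) - 1 = g * cofactor (skewCharPoly a) * h)
    {x : Fin n → F} :
    x ∈ blockDual θ a 𝒞 ↔ ∃ w, toPoly x * cofactor (skewCharPoly a) = w * hPerp θ k h := by
  have hf := hasDegree_skewCharPoly a
  obtain ⟨hm0, hfq⟩ := period_spec hθ hf (coeff_zero_skewCharPoly_ne_zero hn ha)
  have hm := φ_iterate_eq_self_of_dvd hθ hdvd
  set f := skewCharPoly a
  set q := cofactor f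
  have : NeZero (period f) := ⟨hm0.ne'⟩
  have hqf := mul_comm_of_eq_X_pow_sub_one hm0 hm hfq
  obtain ⟨hnm, hqd⟩ := hf.le_of_mul (hqf ▸ hasDegree_X_pow_sub_one hm0)
  have hq : DegreeLT q (period f) := hqd.degreeLT (by omega)
  rw [mem_blockDual_iff, ← orthogonal_iff_exists_mul_hPerp hθ hm hh hgh]
  have hQ : ∀ c : Fin n → F, c ᵥ* matQ θ n (skewCharPoly a) =
      cyclicCoeff F (period f) (toPoly c * q) := vecMul_matQ hθ hq
  simp only [hQ]
  obtain ⟨⟨p, hp⟩, h𝒞⟩ := isModuleCodeGenBy_iff.1 h𝒞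
  constructor
  · intro hx y
    -- Codewords represent only the multiples of `g` of degree below `n`. Reducing `y * g` modulo
    -- `f` stays in `R g`, and the discarded part `w f` becomes `w (X ^ m - 1)` after multiplication
    -- by `q`, which has zero coefficient vector.
    obtain ⟨w, r, hw, hr⟩ := exists_eq_mul_add hf (y * g)
    have hr𝒞 : (fun j : Fin n => r.coeff j) ∈ 𝒞 := by
      rw [h𝒞, toPoly_coeff hr]
      refine ⟨y - w * p, ?_⟩
      rw [sub_mul, mul_assoc, ← hp, hw, add_sub_cancel_left]
    have := hx _ hr𝒞
    rw [toPoly_coeff hr] at this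
    rwa [← mul_assoc, hw, add_mul, mul_assoc, ← hfq, map_add, cyclicCoeff_mul_X_pow_sub_one,
      zero_add]
  · intro hx c hc
    obtain ⟨w, hw⟩ := (h𝒞 c).1 hc
    rw [hw, mul_assoc]
    exact hx w

end SemilinearCodes

end

noncomputable section

namespace SemilinearCodes

open Matrix SkewPolynomial Multiplicative

/-! ### Block diagonal generator matrices and bilinear forms -/

section blocks

variable {F : Type*} [Field F] {r : ℕ} {d : Fin r → ℕ}

/-- The embedding of the factor `F^{dᵢ}` into `F^{d₁} × … × F^{dᵣ}`. -/
def blockEmb (F : Type*) [Field F] {r : ℕ} (d : Fin r → ℕ) (i : Fin r) :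
    (Fin (d i) → F) →ₗ[F] ((i : Fin r) × Fin (d i) → F) where
  toFun w x := (Pi.single i w : ∀ i, Fin (d i) → F) x.1 x.2
  map_add' v w := by
    ext x
    rw [Pi.single_add]
    rfl
  map_smul' t w := by
    ext x
    rw [Pi.single_smul]
    rfl

lemma blockEmb_apply_same (i : Fin r) (w : Fin (d i) → F) (j : Fin (d i)) :
    blockEmb F d i w ⟨i, j⟩ = w j := by
  simp [blockEmb]

lemma blockEmb_apply_ne {i i' : Fin r} (h : i' ≠ i) (w : Fin (d i) → F) (j : Fin (d i')) :
    blockEmb F d i w ⟨i', j⟩ = 0 := by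
  simp [blockEmb, Pi.single_eq_of_ne h]

lemma sum_blockEmb (v : (i : Fin r) × Fin (d i) → F) :
    v = ∑ i, blockEmb F d i fun j => v ⟨i, j⟩ := by
  ext ⟨i, j⟩
  rw [Finset.sum_apply, Finset.sum_eq_single i]
  · rw [blockEmb_apply_same]
  · intro i' _ h
    exact blockEmb_apply_ne h.symm _ j
  · simp

lemma blockEmb_mem_prodCode {𝒞 : ∀ i, Submodule F (Fin (d i) → F)} {i : Fin r}
    {w : Fin (d i) → F} (hw : w ∈ 𝒞 i) : blockEmb F d i w ∈ prodCode 𝒞 := by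
  intro i'
  by_cases h : i' = i
  · subst h
    simpa only [blockEmb_apply_same] using hw
  · simp only [blockEmb_apply_ne h]
    exact (𝒞 i').zero_mem

lemma blockDiagonal'_row {s : Fin r → ℕ} (G : ∀ i, Matrix (Fin (s i)) (Fin (d i)) F)
    (x : (i : Fin r) × Fin (s i)) :
    (fun y => blockDiagonal' G x y) = blockEmb F d x.1 fun j => G x.1 x.2 j := by
  obtain ⟨i, k⟩ := x
  ext ⟨i', j⟩
  by_cases h : i' = i
  · subst h
    rw [blockDiagonal'_apply_eq, blockEmb_apply_same]
  · rw [blockDiagonal'_apply_ne _ _ _ (Ne.symm h), blockEmb_apply_ne h]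

lemma IsGeneratorMatrix.blockDiagonal' {s : Fin r → ℕ}
    {G : ∀ i, Matrix (Fin (s i)) (Fin (d i)) F} {𝒞 : ∀ i, Submodule F (Fin (d i) → F)}
    (h : ∀ i, IsGeneratorMatrix (G i) (𝒞 i)) :
    IsGeneratorMatrix (Matrix.blockDiagonal' G) (prodCode 𝒞) := by
  set row : ((i : Fin r) × Fin (s i)) → ((i : Fin r) × Fin (d i)) → F :=
    fun x => blockEmb F d x.1 fun j => G x.1 x.2 j with hrow
  have hrows : (fun x y => Matrix.blockDiagonal' G x y) = row :=
    funext fun x => blockDiagonal'_row G x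
  change LinearIndependent F (fun x y => Matrix.blockDiagonal' G x y) ∧
    Submodule.span F (Set.range fun x y => Matrix.blockDiagonal' G x y) = prodCode 𝒞
  rw [hrows]
  constructor
  · rw [Fintype.linearIndependent_iff]
    rintro c hc ⟨i, k⟩
    refine Fintype.linearIndependent_iff.1 (h i).1 (fun k => c ⟨i, k⟩) ?_ k
    ext j
    have hj := congrFun hc ⟨i, j⟩
    rw [Finset.sum_apply, Fintype.sum_sigma, Finset.sum_eq_single i] at hj
    · rw [Finset.sum_apply]
      simp only [hrow, Pi.smul_apply, blockEmb_apply_same] at hj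
      exact hj
    · intro i' _ hne
      refine Finset.sum_eq_zero fun k' _ => ?_
      rw [Pi.smul_apply, hrow]
      simp only [blockEmb_apply_ne hne.symm, smul_zero]
    · simp
  · apply le_antisymm
    · rw [Submodule.span_le]
      rintro _ ⟨⟨i, k⟩, rfl⟩
      refine blockEmb_mem_prodCode ?_
      rw [← (h i).2]
      exact Submodule.subset_span ⟨k, rfl⟩
    · intro v hv
      rw [sum_blockEmb v]
      refine Submodule.sum_mem _ fun i _ => ?_
      have hvi := hv i
      rw [← (h i).2] at hvi
      have hmap := Submodule.mem_map_of_mem (f := blockEmb F d i) hvi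
      rw [Submodule.map_span] at hmap
      refine Submodule.span_mono ?_ hmap
      rintro _ ⟨_, ⟨k, rfl⟩, rfl⟩
      exact ⟨⟨i, k⟩, rfl⟩

lemma IsGeneratorMatrix.mul {ι κ : Type*} [Fintype ι] [DecidableEq ι] {G : Matrix κ ι F}
    {𝒞 : Submodule F (ι → F)} (h : IsGeneratorMatrix G 𝒞) {A : Matrix ι ι F} (hA : IsUnit A) :
    IsGeneratorMatrix (G * A) (codeMul 𝒞 A) := by
  have hrow : (fun k j => (G * A) k j) = A.vecMulLinear ∘ fun k j => G k j := by
    ext k j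
    rfl
  change LinearIndependent F (fun k j => (G * A) k j) ∧
    Submodule.span F (Set.range fun k j => (G * A) k j) = codeMul 𝒞 A
  rw [hrow]
  refine ⟨LinearIndependent.map' h.1 _ ?_, ?_⟩
  · rw [LinearMap.ker_eq_bot]
    exact vecMul_injective_of_isUnit hA
  · rw [Set.range_comp, ← Submodule.map_span]
    exact congrArg (Submodule.map A.vecMulLinear) h.2

lemma vecMul_blockDiagonal'_apply (B : ∀ i, Matrix (Fin (d i)) (Fin (d i)) F)
    (v : (i : Fin r) × Fin (d i) → F) (i : Fin r) (j : Fin (d i)) :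
    (v ᵥ* Matrix.blockDiagonal' B) ⟨i, j⟩ = ((fun k => v ⟨i, k⟩) ᵥ* B i) j := by
  rw [vecMul, vecMul, dotProduct, dotProduct, Fintype.sum_sigma, Finset.sum_eq_single i]
  · simp only [blockDiagonal'_apply_eq]
  · intro i' _ h
    exact Finset.sum_eq_zero fun k _ => by rw [blockDiagonal'_apply_ne _ _ _ h, mul_zero]
  · simp

lemma dualWrt_prodCode (B : ∀ i, Matrix (Fin (d i)) (Fin (d i)) F)
    (𝒞 : ∀ i, Submodule F (Fin (d i) → F)) :
    dualWrt (Matrix.blockDiagonal' B) (prodCode 𝒞) = prodCode fun i => dualWrt (B i) (𝒞 i) := by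
  have hdot : ∀ x c : (i : Fin r) × Fin (d i) → F, (x ᵥ* Matrix.blockDiagonal' B) ⬝ᵥ c =
      ∑ i, ((fun k => x ⟨i, k⟩) ᵥ* B i) ⬝ᵥ fun k => c ⟨i, k⟩ := fun x c => by
    rw [dotProduct, Fintype.sum_sigma]
    simp only [vecMul_blockDiagonal'_apply]
    rfl
  ext x
  constructor
  · intro hx i c hc
    have := hx _ (blockEmb_mem_prodCode (𝒞 := 𝒞) hc)
    rw [hdot, Finset.sum_eq_single i] at this
    · simpa only [blockEmb_apply_same] using this
    · intro i' _ h
      simp only [blockEmb_apply_ne h]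
      exact dotProduct_zero _
    · simp
  · intro hx c hc
    rw [hdot]
    exact Finset.sum_eq_zero fun i _ => hx i _ (hc i)

/-- The form is transported along `C`: its value on `x` and `c C` is that of `B` on `x C⁻¹` and `c`.
-/
lemma dualWrt_codeMul {ι : Type*} [Fintype ι] [DecidableEq ι] {C : Matrix ι ι F} (hC : IsUnit C)
    (B : Matrix ι ι F) (𝒞 : Submodule F (ι → F)) :
    dualWrt (C⁻¹ * B * (C⁻¹)ᵀ) (codeMul 𝒞 C) = codeMul (dualWrt B 𝒞) C := by
  have hdet := (isUnit_iff_isUnit_det C).1 hC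
  have hdot : ∀ x c : ι → F, (x ᵥ* (C⁻¹ * B * (C⁻¹)ᵀ)) ⬝ᵥ (c ᵥ* C) =
      ((x ᵥ* C⁻¹) ᵥ* B) ⬝ᵥ c := fun x c => by
    rw [← mulVec_transpose C c, dotProduct_mulVec, vecMul_vecMul, mul_assoc, ← transpose_mul,
      mul_nonsing_inv C hdet, transpose_one, mul_one, vecMul_vecMul]
  ext x
  constructor
  · intro hx
    refine ⟨x ᵥ* C⁻¹, fun c hc => ?_, ?_⟩
    · rw [← hdot]
      exact hx _ ⟨c, hc, rfl⟩
    · rw [vecMulLinear_apply, vecMul_vecMul, nonsing_inv_mul C hdet, vecMul_one]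
  · rintro ⟨y, hy, rfl⟩ _ ⟨c, hc, rfl⟩
    rw [vecMulLinear_apply, vecMulLinear_apply, hdot, vecMul_vecMul y, mul_nonsing_inv C hdet,
      vecMul_one]
    exact hy c hc

end blocks

section

variable {F : Type*} [Field F] {θ : F ≃+* F}

lemma isTCode_codeMul_prodCode {r : ℕ} {d : Fin r → ℕ} {a : ∀ i, Fin (d i) → F}
    {M C : Matrix ((i : Fin r) × Fin (d i)) ((i : Fin r) × Fin (d i)) F} (hC : IsUnit C)
    (hT : ∀ v, semilin θ M v =
      semilin θ (Matrix.blockDiagonal' fun i => companion (a i)) (v ᵥ* C⁻¹) ᵥ* C)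
    {𝒞 : ∀ i, Submodule F (Fin (d i) → F)} (h𝒞 : ∀ i, IsTCode θ (companion (a i)) (𝒞 i)) :
    IsTCode θ M (codeMul (prodCode 𝒞) C) := by
  rintro _ ⟨v, hv, rfl⟩
  refine ⟨_, ?_, (hT _).symm⟩
  rw [vecMulLinear_apply, vecMul_vecMul, mul_nonsing_inv C ((isUnit_iff_isUnit_det C).1 hC),
    vecMul_one]
  intro i
  simp only [semilin, vecMul_blockDiagonal'_apply]
  exact h𝒞 i _ (hv i)

variable [MulSemiringAction (Multiplicative ℕ) F]

lemma quasiB_eq {r : ℕ} {d : Fin r → ℕ} (a : ∀ i, Fin (d i) → F)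
    (C : Matrix ((i : Fin r) × Fin (d i)) ((i : Fin r) × Fin (d i)) F) :
    quasiB θ a C = C⁻¹ * Matrix.blockDiagonal' (fun i => blockB θ (a i)) * (C⁻¹)ᵀ := by
  rw [quasiB, blockDiagonal'_transpose, Matrix.mul_assoc C⁻¹ (Matrix.blockDiagonal' _),
    ← blockDiagonal'_mul]
  rfl

lemma quasiDual_eq {r : ℕ} {d : Fin r → ℕ} (a : ∀ i, Fin (d i) → F)
    {C : Matrix ((i : Fin r) × Fin (d i)) ((i : Fin r) × Fin (d i)) F} (hC : IsUnit C)
    (𝒞 : ∀ i, Submodule F (Fin (d i) → F)) :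
    quasiDual θ a C (codeMul (prodCode 𝒞) C) =
      codeMul (prodCode fun i => blockDual θ (a i) (𝒞 i)) C := by
  rw [quasiDual, quasiB_eq, dualWrt_codeMul hC, dualWrt_prodCode]
  rfl

/-- The left ideal `R p ∩ R q` is principal, and any generator of it will do. -/
lemma exists_isLLCM (p q : SkewPolynomial F) : ∃ l, IsLLCM p q l := by
  obtain ⟨l, hl, hmin⟩ := exists_span_singleton (leftIdeal p ⊓ leftIdeal q)
  obtain ⟨u, hu⟩ := Submodule.mem_span_singleton.1 hl.1
  obtain ⟨v, hv⟩ := Submodule.mem_span_singleton.1 hl.2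
  refine ⟨l, ⟨u, hu.symm⟩, ⟨v, hv.symm⟩, ?_⟩
  rintro x ⟨u', hu'⟩ ⟨v', hv'⟩
  exact hmin x ⟨Submodule.mem_span_singleton.2 ⟨u', hu'.symm⟩,
    Submodule.mem_span_singleton.2 ⟨v', hv'.symm⟩⟩

/-! ### The dual of a single module code -/

section single

variable {n : ℕ} {a : Fin n → F} {g : SkewPolynomial F} {𝒞 : Submodule F (Fin n → F)}

lemma right_factor_ne_zero {p : SkewPolynomial F} (hp : skewCharPoly a = p * g) : g ≠ 0 := by
  rintro rfl
  exact (hasDegree_skewCharPoly a).ne_zero (by rw [hp, mul_zero])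

lemma IsModuleCodeGenBy.hasDegree_finrank (hθ : ∀ x : F, ofAdd 1 • x = θ x)
    (h𝒞 : IsModuleCodeGenBy (skewCharPoly a) g 𝒞) {p : SkewPolynomial F}
    (hp : skewCharPoly a = p * g) : HasDegree p (Module.finrank F 𝒞) := by
  have hp0 : p ≠ 0 := by
    rintro rfl
    exact (hasDegree_skewCharPoly a).ne_zero (by rw [hp, zero_mul])
  obtain ⟨k, hk⟩ := exists_hasDegree hp0
  rwa [h𝒞.finrank_eq hθ hp hk]

variable [Finite F]

/-- From `X ^ m - 1 = q f = (q p) g` the factor `g` is moved to the front. Thus `h = p` is an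
admissible choice. -/
lemma X_pow_period_sub_one_eq (hθ : ∀ x : F, ofAdd 1 • x = θ x) (hn : 0 < n) (ha : a ⟨0, hn⟩ ≠ 0)
    (hdvd : orderOf (θ : RingAut F) ∣ period (skewCharPoly a)) {p : SkewPolynomial F}
    (hp : skewCharPoly a = p * g) :
    X ^ period (skewCharPoly a) - 1 = g * cofactor (skewCharPoly a) * p := by
  obtain ⟨hm0, hfq⟩ :=
    period_spec hθ (hasDegree_skewCharPoly a) (coeff_zero_skewCharPoly_ne_zero hn ha)
  have hm := φ_iterate_eq_self_of_dvd hθ hdvd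
  have h := mul_comm_of_eq_X_pow_sub_one hm0 hm hfq
  rw [mul_assoc]
  refine mul_comm_of_eq_X_pow_sub_one hm0 hm (h.trans ?_)
  conv_lhs => rw [hp]
  rw [mul_assoc, ← hp]

lemma cofactor_ne_zero (hθ : ∀ x : F, ofAdd 1 • x = θ x) (hn : 0 < n) (ha : a ⟨0, hn⟩ ≠ 0) :
    cofactor (skewCharPoly a) ≠ 0 := by
  obtain ⟨hm0, hfq⟩ :=
    period_spec hθ (hasDegree_skewCharPoly a) (coeff_zero_skewCharPoly_ne_zero hn ha)
  intro h
  exact (hasDegree_X_pow_sub_one (F := F) hm0).ne_zero (by rw [hfq, h, mul_zero])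

/-- The dual of `(g)` is generated by the left factor of `llcm(h^⊥, q_f)` modulo `q_f`. -/
lemma exists_isModuleCodeGenBy_blockDual (hθ : ∀ x : F, ofAdd 1 • x = θ x) (hn : 0 < n)
    (ha : a ⟨0, hn⟩ ≠ 0) (hdvd : orderOf (θ : RingAut F) ∣ period (skewCharPoly a))
    (h𝒞 : IsModuleCodeGenBy (skewCharPoly a) g 𝒞) {h l : SkewPolynomial F}
    (hgh : X ^ period (skewCharPoly a) - 1 = g * cofactor (skewCharPoly a) * h)
    (hl : IsLLCM (hPerp θ (Module.finrank F 𝒞) h) (cofactor (skewCharPoly a)) l) :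
    ∃ g', l = g' * cofactor (skewCharPoly a) ∧
      IsModuleCodeGenBy (skewCharPoly a) g' (blockDual θ a 𝒞) := by
  obtain ⟨⟨p, hp⟩, -⟩ := isModuleCodeGenBy_iff.1 h𝒞
  obtain ⟨hm0, hfq⟩ :=
    period_spec hθ (hasDegree_skewCharPoly a) (coeff_zero_skewCharPoly_ne_zero hn ha)
  have hq0 := cofactor_ne_zero hθ hn ha
  -- Cancelling `g q_f` shows that `h` is forced to be the left factor `p` of `f`, so its degree is
  -- the dimension of the code.
  obtain rfl : h = p := mul_left_cancel₀ (mul_ne_zero (right_factor_ne_zero hp) hq0)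
    (hgh.symm.trans (X_pow_period_sub_one_eq hθ hn ha hdvd hp))
  have hh := h𝒞.hasDegree_finrank hθ hp
  obtain ⟨⟨u, hu⟩, ⟨g', hg'⟩, hmin⟩ := hl
  refine ⟨g', hg', isModuleCodeGenBy_iff.2 ⟨?_, fun c => ?_⟩⟩
  · have : NeZero (period (skewCharPoly a)) := ⟨hm0.ne'⟩
    -- `X ^ m - 1` has zero coefficient vector, hence is orthogonal to everything and lies in `R
    -- h^⊥`. It also lies in `R q_f`, so it is a multiple of `l = g' q_f`, and cancelling `q_f`
    -- makes `g'` a right divisor of `f`.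
    have hz : ∃ w, (X ^ period (skewCharPoly a) - 1 : SkewPolynomial F) =
        w * hPerp θ (Module.finrank F 𝒞) h := by
      refine (orthogonal_iff_exists_mul_hPerp hθ (φ_iterate_eq_self_of_dvd hθ hdvd) hh hgh _).1
        fun y => ?_
      rw [← one_mul (X ^ _ - 1), cyclicCoeff_mul_X_pow_sub_one, zero_dotProduct]
    obtain ⟨w, hw⟩ := hmin _ hz ⟨_, hfq⟩
    refine ⟨w, mul_right_cancel₀ hq0 ?_⟩
    rw [← hfq, hw, hg', mul_assoc]
  · rw [mem_blockDual_iff_exists_mul_hPerp hθ hn ha hdvd h𝒞 hh hgh]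
    constructor
    · intro hw
      obtain ⟨w, hw⟩ := hmin _ hw ⟨_, rfl⟩
      exact ⟨w, mul_right_cancel₀ hq0 (by rw [hw, hg', mul_assoc])⟩
    · rintro ⟨w, hw⟩
      exact ⟨w * u, by rw [hw, mul_assoc, ← hg', hu, mul_assoc]⟩

lemma exists_isDualGenerator (hθ : ∀ x : F, ofAdd 1 • x = θ x) (hn : 0 < n)
    (ha : a ⟨0, hn⟩ ≠ 0) (hdvd : orderOf (θ : RingAut F) ∣ period (skewCharPoly a))
    (h𝒞 : IsModuleCodeGenBy (skewCharPoly a) g 𝒞) :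
    ∃ h l gs u, IsDualGenerator θ (skewCharPoly a) g 𝒞 h l gs u := by
  obtain ⟨⟨p, hp⟩, -⟩ := isModuleCodeGenBy_iff.1 h𝒞
  have hgh := X_pow_period_sub_one_eq hθ hn ha hdvd hp
  obtain ⟨l, hl⟩ := exists_isLLCM (hPerp θ (Module.finrank F 𝒞) p) (cofactor (skewCharPoly a))
  obtain ⟨g', hg', -⟩ := exists_isModuleCodeGenBy_blockDual hθ hn ha hdvd h𝒞 hgh hl
  obtain ⟨u, hu⟩ := exists_toQuot_eq a g'
  refine ⟨p, l, g', u, (h𝒞.hasDegree_finrank hθ hp).2, hgh, hl, ?_, hu⟩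
  rw [hg', sub_self]
  exact Submodule.zero_mem _

lemma isModuleCode_blockDual (hθ : ∀ x : F, ofAdd 1 • x = θ x) (hn : 0 < n)
    (ha : a ⟨0, hn⟩ ≠ 0) (hdvd : orderOf (θ : RingAut F) ∣ period (skewCharPoly a))
    (h𝒞 : IsModuleCodeGenBy (skewCharPoly a) g 𝒞) :
    IsModuleCode (skewCharPoly a) (blockDual θ a 𝒞) := by
  obtain ⟨h, l, gs, u, -, hgh, hl, -, -⟩ := exists_isDualGenerator hθ hn ha hdvd h𝒞
  obtain ⟨g', -, hg'⟩ := exists_isModuleCodeGenBy_blockDual hθ hn ha hdvd h𝒞 hgh hl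
  exact ⟨g', hg'⟩

lemma IsDualGenerator.isGeneratorMatrix (hθ : ∀ x : F, ofAdd 1 • x = θ x) (hn : 0 < n)
    (ha : a ⟨0, hn⟩ ≠ 0) (hdvd : orderOf (θ : RingAut F) ∣ period (skewCharPoly a))
    (h𝒞 : IsModuleCodeGenBy (skewCharPoly a) g 𝒞) {h l gs : SkewPolynomial F} {u : Fin n → F}
    (hD : IsDualGenerator θ (skewCharPoly a) g 𝒞 h l gs u) :
    IsGeneratorMatrix (orbitMatrix θ (companion a) u (Module.finrank F (blockDual θ a 𝒞)))
      (blockDual θ a 𝒞) := by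
  obtain ⟨-, hgh, hl, hgs, hu⟩ := hD
  obtain ⟨g', hg', hgen⟩ := exists_isModuleCodeGenBy_blockDual hθ hn ha hdvd h𝒞 hgh hl
  obtain ⟨⟨p, hp⟩, -⟩ := isModuleCodeGenBy_iff.1 hgen
  obtain ⟨-, hfq⟩ :=
    period_spec hθ (hasDegree_skewCharPoly a) (coeff_zero_skewCharPoly_ne_zero hn ha)
  refine hgen.isGeneratorMatrix hθ hp (hgen.hasDegree_finrank hθ hp) (hu.trans ?_)
  obtain ⟨w, hw⟩ := Submodule.mem_span_singleton.1 hgs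
  -- Modulo `X ^ m - 1 = f q_f` both `gs q_f` and `g' q_f` equal `l`. Cancelling `q_f` gives `gs ≡
  -- g'` modulo `R f`, so every admissible `gs` yields the same rows.
  refine mkQ_leftIdeal_eq_iff.2 ⟨w, mul_right_cancel₀ (cofactor_ne_zero hθ hn ha) ?_⟩
  rw [add_mul, mul_assoc, ← hfq, ← hg', ← smul_eq_mul w, hw, sub_add_cancel]

end single

end

end SemilinearCodes

end

open SemilinearCodes Matrix in
theorem theorem3p20 {F : Type*} [Field F] [Finite F]
    -- the automorphism `θ`, and the action through which `SkewPolynomial F` is `F[X; θ]`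
    (θ : F ≃+* F) [MulSemiringAction (Multiplicative ℕ) F]
    (hθ : ∀ x : F, Multiplicative.ofAdd 1 • x = θ x)
    -- `T = Θ ∘ M = C⁻¹ (Θ ∘ diag(M₁, …, Mᵣ)) C` with companion matrices `Mᵢ`, `a_{i,0} ≠ 0`
    (r : ℕ) (d : Fin r → ℕ) (hd : ∀ i, 0 < d i)
    (a : ∀ i, Fin (d i) → F) (ha : ∀ i, a i ⟨0, hd i⟩ ≠ 0)
    (M C : Matrix ((i : Fin r) × Fin (d i)) ((i : Fin r) × Fin (d i)) F) (hC : IsUnit C)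
    (hT : ∀ v, semilin θ M v =
      semilin θ (blockDiagonal' fun i => companion (a i)) (v ᵥ* C⁻¹) ᵥ* C)
    -- the order of `θ` divides every `mᵢ`
    (hdvd : ∀ i, orderOf (θ : RingAut F) ∣ period (skewCharPoly (a i)))
    -- the module codes `𝒞ᵢ = (gᵢ)`
    (g : Fin r → SkewPolynomial F) (𝒞 : ∀ i, Submodule F (Fin (d i) → F))
    (h𝒞 : ∀ i, IsModuleCodeGenBy (skewCharPoly (a i)) (g i) (𝒞 i)) :
    quasiDual θ a C (codeMul (prodCode 𝒞) C) =
      codeMul (prodCode fun i => blockDual θ (a i) (𝒞 i)) C ∧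
    (∀ i, blockDual θ (a i) (𝒞 i) = euclDual (codeMul (𝒞 i) (blockB θ (a i)))) ∧
    (∀ i, IsModuleCode (skewCharPoly (a i)) (blockDual θ (a i) (𝒞 i))) ∧
    IsProductTCode θ a M C (quasiDual θ a C (codeMul (prodCode 𝒞) C)) ∧
    (∃ (h l gs : Fin r → SkewPolynomial F) (u : ∀ i, Fin (d i) → F),
      ∀ i, IsDualGenerator θ (skewCharPoly (a i)) (g i) (𝒞 i) (h i) (l i) (gs i) (u i)) ∧
    (∀ (h l gs : Fin r → SkewPolynomial F) (u : ∀ i, Fin (d i) → F),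
      (∀ i, IsDualGenerator θ (skewCharPoly (a i)) (g i) (𝒞 i) (h i) (l i) (gs i) (u i)) →
      (∀ i, IsGeneratorMatrix
        (orbitMatrix θ (companion (a i)) (u i) (Module.finrank F (blockDual θ (a i) (𝒞 i))))
        (blockDual θ (a i) (𝒞 i))) ∧
      IsGeneratorMatrix
        ((blockDiagonal' fun i => orbitMatrix θ (companion (a i)) (u i)
          (Module.finrank F (blockDual θ (a i) (𝒞 i)))) * C)
        (quasiDual θ a C (codeMul (prodCode 𝒞) C))) := by
  have hmod : ∀ i, IsModuleCode (skewCharPoly (a i)) (blockDual θ (a i) (𝒞 i)) :=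
    fun i => isModuleCode_blockDual hθ (hd i) (ha i) (hdvd i) (h𝒞 i)
  have hdual := quasiDual_eq (θ := θ) a hC 𝒞
  refine ⟨hdual, fun i => dualWrt_eq_euclDual (blockB_transpose (a i)) (𝒞 i), hmod,
    ⟨?_, _, hmod, hdual⟩, ?_, ?_⟩
  · rw [hdual]
    exact isTCode_codeMul_prodCode hC hT fun i => (hmod i).isTCode hθ
  · choose h l gs u H using fun i => exists_isDualGenerator hθ (hd i) (ha i) (hdvd i) (h𝒞 i)
    exact ⟨h, l, gs, u, H⟩
  · intro h l gs u H
    have hgen := fun i => (H i).isGeneratorMatrix hθ (hd i) (ha i) (hdvd i) (h𝒞 i)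
    refine ⟨hgen, ?_⟩
    rw [hdual]
    exact (IsGeneratorMatrix.blockDiagonal' hgen).mul hC
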